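/- **Setting.** Let $\Gamma\subset\mathbb R^2$ be a compact, connected, piecewise smooth boundary part, given by a continuous, piecewise twice continuously differentiable (up to the end points of each piece) path $\gamma:[a,b]\to\Gamma$ onto $\Gamma$ which is either injective on $[a,b]$ (open $\Gamma$) or satisfies $\gamma(a)=\gamma(b)$ and is injective on $[a,b)$ (closed $\Gamma$; then $\gamma$ also denotes the $(b-a)$-periodic extension). The one-sided derivatives satisfy $\gamma'_\ell(t)\ne0$ on $(a,b]$, $\gamma'_r(t)\neq 0$ on $[a,b)$, and $\gamma'_\ell(t)+c\,\gamma'_r(t)\ne 0$ for all $c>0$ and all $t\in[a,b]$ (closed) resp. $t\in(a,b)$ (open). Integrals over subsets of $\Gamma$ are with respect to arclength, and $|\omega|$ is the arclength of $\omega\subseteq\Gamma$. Put $$|u|_{H^{1/2}(\omega)}^2=\int_\omega\int_\omega\frac{|u(x)-u(y)|^2}{|x-y|^2}\,dy\,dx,\qquad \|u\|_{H^{1/2}(\omega)}^2=\|u\|^2_{L^2(\omega)}+|u|_{H^{1/2}(\omega)}^2,$$ let $H^{1/2}(\Gamma)$ be the space of real $u\in L^2(\Gamma)$ with $\|u\|_{H^{1/2}(\Gamma)}<\infty$,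 and let $\widetilde H^{-1/2}(\Gamma)$ be its dual with the dual norm; $\psi\in L^2(\Gamma)$ acts on $H^{1/2}(\Gamma)$ by $u\mapsto\int_\Gamma u\psi\,dx$. Let $V:\widetilde H^{-1/2}(\Gamma)\to H^{1/2}(\Gamma)$ be an elliptic isomorphism, i.e. a linear homeomorphism with $\langle V\psi,\psi\rangle\ge\alpha\|\psi\|^2_{\widetilde H^{-1/2}(\Gamma)}$ for some $\alpha>0$ and all $\psi$. A mesh $\mathcal T_h$ on $\Gamma$ is given by parameters $\check z_0<\dots<\check z_n$ with $\check z_0=a$, $\check z_n=b$ (open) resp. $\check z_n=\check z_0+(b-a)$ (closed). Its elements are $T_j=\gamma([\check z_{j-1},\check z_j])$, $j=1,\dots,n$, of arclength $h_{T_j}$, and its set of nodes is $\mathcal N_h=\{\gamma(\check z_0),\dots,\gamma(\check z_n)\}$. For closed $\Gamma$ it is assumed that $h_T\le|\Gamma|/4$ for all $T\in\mathcal T_h$. Let $\kappa(\mathcal T_h)=\max\{h_T/h_{T'}:T,T'\in\mathcal T_h,\ T\cap T'\ne\emptyset\}$, $\omega_h(z)=\bigcup\{T\in\mathcal T_h: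 z\in T\}$, $\omega_h^0(T)=T$ and $\omega_h^{m+1}(T)=\bigcup\{T'\in\mathcal T_h:T'\cap\omega_h^m(T)\neq\emptyset\}$. Let $\mathcal X_h\subseteq L^2(\Gamma)$ be a linear subspace, $f\in H^{1/2}(\Gamma)$, let $\phi\in\widetilde H^{-1/2}(\Gamma)$ solve $\langle V\phi,\psi\rangle=\langle f,\psi\rangle$ for all $\psi\in\widetilde H^{-1/2}(\Gamma)$, and let $\phi_h\in\mathcal X_h$ be a Galerkin solution, i.e. $\int_\Gamma (V\phi_h)\psi_h\,dx=\int_\Gamma f\psi_h\,dx$ for all $\psi_h\in\mathcal X_h$. Put $$r_h=f-V\phi_h,\qquad \eta_h=\Big(\sum_{z\in\mathcal N_h}|r_h|^2_{H^{1/2}(\omega_h(z))}\Big)^{1/2}.$$ For $m\in\mathbb N_0$ and $q\in(0,1]$, the assumptions (A1)–(A2) say that for every $T\in\mathcal T_h$ there is $\psi_T\in\mathcal X_h$ such that * (A1) $\operatorname{supp}(\psi_T)$ is connected and $T\subseteq\operatorname{supp}(\psi_T)\subseteq\omega_h^m(T)$; * (A2) $\|1-\psi_T\|^2_{L^2(\operatorname{supp}(\psi_T))}\le(1-q)\,|\operatorname{supp}(\psi_T)|$.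 **Theorem 3.1.** 1. (Efficiency) There is a constant $C_{\rm eff}>0$ depending only on $V$ such that, for all $\mathcal T_h,\mathcal X_h,f,\phi,\phi_h$ as above, $\eta_h\le C_{\rm eff}\,\|\phi-\phi_h\|_{\widetilde H^{-1/2}(\Gamma)}$. 2. (Reliability) For all $m\in\mathbb N_0$, $\kappa\in\mathbb R$ and $q\in(0,1]$ there is a constant $C_{\rm rel}>0$ depending only on $V$, $\Gamma$, $m$, $\kappa$ and $q$ such that, for all $\mathcal T_h,\mathcal X_h,f,\phi,\phi_h$ as above with $\kappa(\mathcal T_h)\le\kappa$ and (A1)–(A2), $\|\phi-\phi_h\|_{\widetilde H^{-1/2}(\Gamma)}\le C_{\rm rel}\,\eta_h$. -/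

import Mathlib

open MeasureTheory Set
open scoped ENNReal NNReal

noncomputable section

namespace FaermannBEM

/-- The Euclidean plane. -/
abbrev Plane : Type := EuclideanSpace ℝ (Fin 2)

/-- Arclength on a subset `ω` of the plane: one-dimensional Hausdorff measure restricted to `ω`.
All integrals `∫_ω … dx` are taken with respect to this measure. -/
def arc (ω : Set Plane) : Measure Plane := (Measure.hausdorffMeasure 1).restrict ω

/-- The arclength `|ω|`. -/
def arclength (ω : Set Plane) : ℝ := (arc ω univ).toReal

/-- `L²(ω)`, real-valued, with respect to arclength. -/
abbrev L2 (ω : Set Plane) : Type := Lp ℝ 2 (arc ω)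

/-- The square of the Sobolev-Slobodeckij seminorm,
`|u|²_{H^{1/2}(ω)} = ∫_ω ∫_ω |u(x) - u(y)|² / |x - y|² dy dx`. The diagonal contributes `0 / 0 = 0`
(it is a null set anyway). -/
def slobodeckijSq (ω : Set Plane) (u : Plane → ℝ) : ℝ≥0∞ :=
  ∫⁻ x, ∫⁻ y, ‖u x - u y‖ₑ ^ 2 / ‖x - y‖ₑ ^ 2 ∂(arc ω) ∂(arc ω)

/-- The difference quotient under the seminorm, a function on the product. -/
def diffQuot (u : Plane → ℝ) (p : Plane × Plane) : ℝ := (u p.1 - u p.2) / ‖p.1 - p.2‖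

section Sobolev

variable {ω : Set Plane}

theorem slobodeckijSq_congr {u v : Plane → ℝ} (h : u =ᵐ[arc ω] v) :
    slobodeckijSq ω u = slobodeckijSq ω v := by
  unfold slobodeckijSq
  refine lintegral_congr_ae ?_
  filter_upwards [h] with x hx
  refine lintegral_congr_ae ?_
  filter_upwards [h] with y hy
  rw [hx, hy]

theorem diffQuot_add (u v : Plane → ℝ) : diffQuot (u + v) = diffQuot u + diffQuot v := by
  ext p
  simp only [diffQuot, Pi.add_apply]
  ring

theorem diffQuot_smul (c : ℝ) (u : Plane → ℝ) : diffQuot (c • u) = c • diffQuot u := by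
  ext p
  simp only [diffQuot, Pi.smul_apply, smul_eq_mul]
  ring

theorem aestronglyMeasurable_diffQuot {u : Plane → ℝ} (hu : AEStronglyMeasurable u (arc ω)) :
    AEStronglyMeasurable (diffQuot u) ((arc ω).prod (arc ω)) := by
  have h1 : AEStronglyMeasurable (fun p : Plane × Plane => u p.1) ((arc ω).prod (arc ω)) :=
    hu.comp_quasiMeasurePreserving Measure.quasiMeasurePreserving_fst
  have h2 : AEStronglyMeasurable (fun p : Plane × Plane => u p.2) ((arc ω).prod (arc ω)) :=
    hu.comp_quasiMeasurePreserving Measure.quasiMeasurePreserving_snd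
  have h3 : Measurable (fun p : Plane × Plane => ‖p.1 - p.2‖) := by fun_prop
  exact ((h1.sub h2).aemeasurable.div h3.aemeasurable).aestronglyMeasurable

variable [SFinite (arc ω)]

theorem slobodeckijSq_eq {u : Plane → ℝ} (hu : AEStronglyMeasurable u (arc ω)) :
    slobodeckijSq ω u = eLpNorm (diffQuot u) 2 ((arc ω).prod (arc ω)) ^ 2 := by
  have h := eLpNorm_nnreal_pow_eq_lintegral (f := diffQuot u)
    (μ := (arc ω).prod (arc ω)) (p := 2) (by norm_num)
  norm_num at h
  rw [h, lintegral_prod _ ((aestronglyMeasurable_diffQuot hu).enorm.pow_const 2)]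
  unfold slobodeckijSq
  refine lintegral_congr fun x => lintegral_congr fun y => ?_
  by_cases hxy : x = y
  · simp [hxy, diffQuot]
  · have h0 : ‖x - y‖ ≠ 0 := by simpa [sub_eq_zero] using hxy
    simp only [diffQuot]
    rw [div_eq_mul_inv (u x - u y), enorm_mul, enorm_inv h0, enorm_norm, mul_pow, div_eq_mul_inv,
      ENNReal.inv_pow]

theorem memLp_diffQuot_iff (u : L2 ω) :
    MemLp (diffQuot u) 2 ((arc ω).prod (arc ω)) ↔ slobodeckijSq ω u < ∞ := by
  rw [slobodeckijSq_eq (Lp.aestronglyMeasurable u)]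
  constructor
  · exact fun h => ENNReal.pow_lt_top h.2
  · intro h
    refine ⟨aestronglyMeasurable_diffQuot (Lp.aestronglyMeasurable u), ?_⟩
    by_contra h'
    rw [not_lt_top_iff.1 h'] at h
    simp at h

/-- The square root of `slobodeckijSq`, as an `L²` seminorm of the difference quotient. -/
theorem sqrt_slobodeckijSq (u : L2 ω) :
    √(slobodeckijSq ω u).toReal =
      (eLpNorm (diffQuot u) 2 ((arc ω).prod (arc ω))).toReal := by
  rw [slobodeckijSq_eq (Lp.aestronglyMeasurable u), ENNReal.toReal_pow,
    Real.sqrt_sq ENNReal.toReal_nonneg]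

theorem slobodeckijSq_smul (c : ℝ) (u : L2 ω) :
    slobodeckijSq ω ((c • u : L2 ω) : Plane → ℝ) = ‖c‖ₑ ^ 2 * slobodeckijSq ω u := by
  rw [slobodeckijSq_congr (Lp.coeFn_smul c u),
    slobodeckijSq_eq ((Lp.aestronglyMeasurable u).const_smul c), diffQuot_smul,
    eLpNorm_const_smul, mul_pow, slobodeckijSq_eq (Lp.aestronglyMeasurable u)]

theorem slobodeckijSq_add_lt_top {u v : L2 ω} (hu : slobodeckijSq ω u < ∞)
    (hv : slobodeckijSq ω v < ∞) :
    slobodeckijSq ω ((u + v : L2 ω) : Plane → ℝ) < ∞ := by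
  rw [slobodeckijSq_congr (Lp.coeFn_add u v), slobodeckijSq_eq
    ((Lp.aestronglyMeasurable u).add (Lp.aestronglyMeasurable v)), diffQuot_add]
  exact ENNReal.pow_lt_top
    (((memLp_diffQuot_iff u).2 hu).add ((memLp_diffQuot_iff v).2 hv)).2

theorem sqrt_slobodeckijSq_add_le {u v : L2 ω} (hu : slobodeckijSq ω u < ∞)
    (hv : slobodeckijSq ω v < ∞) :
    √(slobodeckijSq ω ((u + v : L2 ω) : Plane → ℝ)).toReal ≤
      √(slobodeckijSq ω u).toReal + √(slobodeckijSq ω v).toReal := by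
  have hu' := (memLp_diffQuot_iff u).2 hu
  have hv' := (memLp_diffQuot_iff v).2 hv
  rw [slobodeckijSq_congr (Lp.coeFn_add u v), sqrt_slobodeckijSq u, sqrt_slobodeckijSq v,
    slobodeckijSq_eq ((Lp.aestronglyMeasurable u).add (Lp.aestronglyMeasurable v)),
    diffQuot_add, ENNReal.toReal_pow, Real.sqrt_sq ENNReal.toReal_nonneg,
    ← ENNReal.toReal_add hu'.2.ne hv'.2.ne]
  exact ENNReal.toReal_mono (ENNReal.add_ne_top.2 ⟨hu'.2.ne, hv'.2.ne⟩)
    (eLpNorm_add_le hu'.1 hv'.1 (by norm_num))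

variable (ω) in
/-- The functions in `L²(ω)` with finite Sobolev-Slobodeckij seminorm. -/
def hHalfSubmodule : Submodule ℝ (L2 ω) where
  carrier := {u | slobodeckijSq ω u < ∞}
  add_mem' := fun hu hv => slobodeckijSq_add_lt_top hu hv
  zero_mem' := by
    change slobodeckijSq ω ((0 : L2 ω) : Plane → ℝ) < ∞
    rw [slobodeckijSq_congr (Lp.coeFn_zero ℝ 2 (arc ω))]
    simp [slobodeckijSq]
  smul_mem' := fun c u hu => by
    change slobodeckijSq ω ((c • u : L2 ω) : Plane → ℝ) < ∞
    rw [slobodeckijSq_smul]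
    exact ENNReal.mul_lt_top (by simp) hu

variable (ω) in
/-- The Sobolev space `H^{1/2}(ω)`, with the Sobolev-Slobodeckij norm (not the `L²` norm). -/
def HHalf : Type := hHalfSubmodule ω

instance : AddCommGroup (HHalf ω) := inferInstanceAs (AddCommGroup (hHalfSubmodule ω))

instance : Module ℝ (HHalf ω) := inferInstanceAs (Module ℝ (hHalfSubmodule ω))

/-- The inclusion `H^{1/2}(ω) ⊆ L²(ω)`. -/
def HHalf.toL2 : HHalf ω →ₗ[ℝ] L2 ω := (hHalfSubmodule ω).subtype

theorem HHalf.toL2_injective : Function.Injective (HHalf.toL2 (ω := ω)) :=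
  Subtype.val_injective

theorem HHalf.slobodeckijSq_lt_top (u : HHalf ω) : slobodeckijSq ω u.toL2 < ∞ := u.property

theorem sqrt_minkowski {a b c d s t : ℝ} (hs : s ≤ a + c) (hs0 : 0 ≤ s) (ht : t ≤ b + d)
    (ht0 : 0 ≤ t) : √(s ^ 2 + t ^ 2) ≤ √(a ^ 2 + b ^ 2) + √(c ^ 2 + d ^ 2) := by
  have h := norm_add_le (Complex.mk a b) (Complex.mk c d)
  rw [Complex.norm_eq_sqrt_sq_add_sq, Complex.norm_eq_sqrt_sq_add_sq,
    Complex.norm_eq_sqrt_sq_add_sq] at h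
  simp only [Complex.add_re, Complex.add_im] at h
  refine le_trans (Real.sqrt_le_sqrt ?_) h
  gcongr

/-- The Sobolev-Slobodeckij norm `‖u‖²_{H^{1/2}(ω)} = ‖u‖²_{L²(ω)} + |u|²_{H^{1/2}(ω)}`. -/
def HHalf.addGroupNorm : AddGroupNorm (HHalf ω) where
  toFun u := √(‖u.toL2‖ ^ 2 + (slobodeckijSq ω u.toL2).toReal)
  map_zero' := by
    rw [map_zero, slobodeckijSq_congr (Lp.coeFn_zero ℝ 2 (arc ω))]
    simp [slobodeckijSq]
  add_le' u v := by
    have h := sqrt_minkowski (norm_add_le u.toL2 v.toL2) (norm_nonneg _)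
      (sqrt_slobodeckijSq_add_le u.slobodeckijSq_lt_top v.slobodeckijSq_lt_top)
      (Real.sqrt_nonneg _)
    simpa only [Real.sq_sqrt ENNReal.toReal_nonneg, map_add] using h
  neg' u := by
    have h := slobodeckijSq_smul (-1 : ℝ) u.toL2
    have h1 : (-1 : ℝ) • u.toL2 = (-u).toL2 := by rw [map_neg]; simp
    rw [h1] at h
    rw [h, map_neg, norm_neg]
    simp
  eq_zero_of_map_eq_zero' u hu := by
    have h0 : ‖u.toL2‖ ^ 2 + (slobodeckijSq ω u.toL2).toReal = 0 :=
      (Real.sqrt_eq_zero (by positivity)).1 hu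
    have h1 : ‖u.toL2‖ ^ 2 = 0 := by
      have := sq_nonneg ‖u.toL2‖
      have := ENNReal.toReal_nonneg (a := slobodeckijSq ω u.toL2)
      linarith
    have h2 : u.toL2 = 0 := by simpa using h1
    exact HHalf.toL2_injective (by rw [h2, map_zero])

instance : NormedAddCommGroup (HHalf ω) := HHalf.addGroupNorm.toNormedAddCommGroup

theorem HHalf.norm_def (u : HHalf ω) :
    ‖u‖ = √(‖u.toL2‖ ^ 2 + (slobodeckijSq ω u.toL2).toReal) := rfl

instance : NormedSpace ℝ (HHalf ω) where
  norm_smul_le c u := by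
    rw [HHalf.norm_def, HHalf.norm_def, map_smul, slobodeckijSq_smul, norm_smul, mul_pow,
      ENNReal.toReal_mul, ENNReal.toReal_pow, toReal_enorm, ← mul_add,
      Real.sqrt_mul (sq_nonneg _), Real.sqrt_sq (norm_nonneg _)]

theorem HHalf.norm_toL2_le (u : HHalf ω) : ‖u.toL2‖ ≤ ‖u‖ := by
  rw [HHalf.norm_def]
  refine Real.le_sqrt_of_sq_le ?_
  have := ENNReal.toReal_nonneg (a := slobodeckijSq ω u.toL2)
  linarith

variable (ω) in
/-- `H̃^{-1/2}(ω)`, the dual space of `H^{1/2}(ω)`, with the dual norm. -/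
abbrev HMinusHalf : Type := StrongDual ℝ (HHalf ω)

/-- `L²(ω) ⊆ H̃^{-1/2}(ω)`: the function `ψ` acts by `u ↦ ∫_ω u ψ dx`. -/
def ofL2 : L2 ω →ₗ[ℝ] HMinusHalf ω where
  toFun ψ := (innerSL ℝ ψ).comp (HHalf.toL2.mkContinuous 1 fun u => by
    simpa using u.norm_toL2_le)
  map_add' ψ χ := by ext u; simp
  map_smul' c ψ := by ext u; simp

theorem ofL2_apply (ψ : L2 ω) (u : HHalf ω) :
    ofL2 ψ u = ∫ x, u.toL2 x * ψ x ∂(arc ω) := by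
  change inner ℝ ψ u.toL2 = _
  rw [L2.inner_def]
  rfl

end Sobolev

/-- A connected, compact, piecewise smooth boundary part `Γ` of the plane, given by a
parametrization `γ : [a, b] → Γ` that is continuous, piecewise twice continuously differentiable
(up to the end points of each piece), injective except that `γ a = γ b` if `Γ` is closed, with
nowhere vanishing one-sided derivatives and without cusps.
If `Γ` is closed then `γ` stands for the `(b - a)`-periodic extension; if `Γ` is open, the values of
`γ` outside `[a, b]` play no role. -/
structure BoundaryPart where
  γ : ℝ → Plane
  a : ℝ
  b : ℝ
  a_lt_b : a < b
  /-- Whether `Γ` is closed (a closed curve) or open (an arc). -/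
  IsClosedCurve : Prop
  periodic : IsClosedCurve → Function.Periodic γ (b - a)
  injOn_closed : IsClosedCurve → InjOn γ (Ico a b)
  injOn_open : ¬ IsClosedCurve → InjOn γ (Icc a b)
  piecewise_smooth : ContinuousOn γ (Icc a b) ∧
    ∃ (N : ℕ) (t : Fin (N + 1) → ℝ), StrictMono t ∧ t 0 = a ∧ t (Fin.last N) = b ∧
      ∀ i : Fin N, ContDiffOn ℝ 2 γ (Icc (t i.castSucc) (t i.succ))
  left_deriv_ne_zero : ∀ t ∈ Ioc a b, derivWithin γ (Iic t) t ≠ 0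
  right_deriv_ne_zero : ∀ t ∈ Ico a b, derivWithin γ (Ici t) t ≠ 0
  no_cusp : ∀ t ∈ Icc a b, (IsClosedCurve ∨ t ∈ Ioo a b) → ∀ c : ℝ, 0 < c →
    derivWithin γ (Iic t) t + c • derivWithin γ (Ici t) t ≠ 0

namespace BoundaryPart

variable (Γ : BoundaryPart)

/-- The point set `Γ`. -/
def carrier : Set Plane := Γ.γ '' Icc Γ.a Γ.b

instance isFiniteMeasure_arc : IsFiniteMeasure (arc Γ.carrier) := by
  obtain ⟨-, N, t, hmono, h0, hN, hsm⟩ := Γ.piecewise_smooth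
  refine ⟨?_⟩
  rw [arc, Measure.restrict_apply_univ]
  have hcover : Γ.carrier ⊆ ⋃ i : Fin N, Γ.γ '' Icc (t i.castSucc) (t i.succ) := by
    rintro _ ⟨s, hs, rfl⟩
    have hex : ∀ k : Fin (N + 1), s ≤ t k → s = Γ.a ∨
        ∃ i : Fin N, s ∈ Icc (t i.castSucc) (t i.succ) := by
      intro k
      induction k using Fin.induction with
      | zero => intro h; exact Or.inl (le_antisymm (h0 ▸ h) hs.1)
      | succ i ih =>
        intro h
        by_cases h' : s ≤ t i.castSucc
        · exact ih h'
        · exact Or.inr ⟨i, (not_le.1 h').le, h⟩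
    rcases hex (Fin.last N) (hN ▸ hs.2) with h | ⟨i, hi⟩
    · have hNpos : 0 < N := by
        rcases Nat.eq_zero_or_pos N with hz | hp
        · subst hz
          have := Γ.a_lt_b
          rw [← h0, ← hN] at this
          exact absurd this (lt_irrefl _)
        · exact hp
      refine mem_iUnion.2 ⟨⟨0, hNpos⟩, s, ⟨?_, ?_⟩, rfl⟩
      · exact le_of_eq (by rw [h, ← h0]; rfl)
      · rw [h, ← h0]
        exact hmono.monotone (Fin.zero_le _)
    · exact mem_iUnion.2 ⟨i, s, hi, rfl⟩
  refine lt_of_le_of_lt (measure_mono hcover) ?_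
  refine lt_of_le_of_lt (measure_iUnion_fintype_le _ _) ?_
  refine ENNReal.sum_lt_top.2 fun i _ => ?_
  have hlt : t i.castSucc < t i.succ := hmono Fin.castSucc_lt_succ
  obtain ⟨K, hK⟩ : ∃ K, LipschitzOnWith K Γ.γ (Icc (t i.castSucc) (t i.succ)) := by
    have hc := (hsm i).continuousOn_derivWithin (uniqueDiffOn_Icc hlt) (by norm_num)
    obtain ⟨C, hC⟩ := isCompact_Icc.exists_bound_of_continuousOn hc
    refine ⟨C.toNNReal, (convex_Icc _ _).lipschitzOnWith_of_nnnorm_derivWithin_le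
      ((hsm i).differentiableOn (by norm_num)) fun x hx => ?_⟩
    rw [← norm_toNNReal]
    exact Real.toNNReal_le_toNNReal (hC x hx)
  refine lt_of_le_of_lt (hK.hausdorffMeasure_image_le zero_le_one) ?_
  rw [hausdorffMeasure_real, Real.volume_Icc]
  exact ENNReal.mul_lt_top (by simp) ENNReal.ofReal_lt_top

/-- A mesh `𝒯_h = {T_1, …, T_n}` on `Γ`, given by the nodes `ž_0 < … < ž_n` in the parameter domain.
If `Γ` is open then `ž_0 = a` and `ž_n = b`. If `Γ` is closed then the nodes run once around the
curve, starting at an arbitrary point, and `h ≤ |Γ| / 4`. -/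
structure Mesh where
  n : ℕ
  z : Fin (n + 1) → ℝ
  strictMono : StrictMono z
  endpoints_closed : Γ.IsClosedCurve → z (Fin.last n) = z 0 + (Γ.b - Γ.a)
  endpoints_open : ¬ Γ.IsClosedCurve → z 0 = Γ.a ∧ z (Fin.last n) = Γ.b
  fine : Γ.IsClosedCurve → ∀ j : Fin n,
    arclength (Γ.γ '' Icc (z j.castSucc) (z j.succ)) ≤ arclength Γ.carrier / 4

namespace Mesh

variable {Γ} (𝒯 : Γ.Mesh)

/-- The element `T_j = γ([ž_{j-1}, ž_j])`. -/
def element (j : Fin 𝒯.n) : Set Plane := Γ.γ '' Icc (𝒯.z j.castSucc) (𝒯.z j.succ)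

open Classical in
/-- The set `𝒩_h` of nodes on `Γ`. In the closed case `γ(ž_0) = γ(ž_n)` is one node. -/
def nodes : Finset Plane := Finset.univ.image fun j => Γ.γ (𝒯.z j)

/-- The arclength `h_T` of the element `T_j`. -/
def size (j : Fin 𝒯.n) : ℝ := arclength (𝒯.element j)

/-- The shape regularity constant `κ(𝒯_h)`, the maximum of `h_T / h_{T'}` over all `T`, `T'` with
`T ∩ T' ≠ ∅`. -/
def kappa : ℝ :=
  sSup {r | ∃ i j, (𝒯.element i ∩ 𝒯.element j).Nonempty ∧ r = 𝒯.size i / 𝒯.size j}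

/-- The node patch `ω_h(z) = ⋃ {T : z ∈ T}`. -/
def nodePatch (z : Plane) : Set Plane := ⋃ (j) (_ : z ∈ 𝒯.element j), 𝒯.element j

/-- The patch `ω_h^m(T_j)` of order `m`. -/
def patch (j : Fin 𝒯.n) : ℕ → Set Plane
  | 0 => 𝒯.element j
  | m + 1 => ⋃ (i) (_ : (𝒯.element i ∩ patch j m).Nonempty), 𝒯.element i

/-- The estimator `(∑_{z ∈ 𝒩_h} |r|²_{H^{1/2}(ω_h(z))})^{1/2}`. -/
def faermann (r : HHalf Γ.carrier) : ℝ :=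
  √(∑ z ∈ 𝒯.nodes, (slobodeckijSq (𝒯.nodePatch z) r.toL2).toReal)

end Mesh

/-- The support of a function on `Γ`. -/
def supp (ψ : Plane → ℝ) : Set Plane := closure {x ∈ Γ.carrier | ψ x ≠ 0}

/-- Inequality (A2) for the function `ψ = ψ_T`:
`‖1 - ψ‖²_{L²(supp ψ)} ≤ (1 - q) |supp ψ|`. -/
def A2 (q : ℝ) (ψ : Plane → ℝ) : Prop :=
  ∫ x, (1 - ψ x) ^ 2 ∂(arc (Γ.supp ψ)) ≤ (1 - q) * arclength (Γ.supp ψ)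

variable {Γ}

/-- Assumption (A1) for the function `ψ = ψ_T` with `T = T_j`. -/
def Mesh.A1 (𝒯 : Γ.Mesh) (m : ℕ) (j : Fin 𝒯.n) (ψ : Plane → ℝ) : Prop :=
  IsConnected (Γ.supp ψ) ∧ 𝒯.element j ⊆ Γ.supp ψ ∧ Γ.supp ψ ⊆ 𝒯.patch j m

/-- The mesh and the discrete space satisfy (A1) and (A2) with parameters `m` and `q`: every element
`T` has a function `ψ_T` in `X` with both properties. -/
def Mesh.SatisfiesA1A2 (𝒯 : Γ.Mesh) (X : Submodule ℝ (L2 Γ.carrier)) (m : ℕ) (q : ℝ) : Prop :=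
  ∀ j : Fin 𝒯.n, ∃ ψ : Plane → ℝ,
    (∃ hψ : MemLp ψ 2 (arc Γ.carrier), hψ.toLp ∈ X) ∧ 𝒯.A1 m j ψ ∧ Γ.A2 q ψ

/-- `V` is elliptic: `⟨V ψ, ψ⟩ ≥ α ‖ψ‖²` for some `α > 0`. -/
def IsElliptic (V : HMinusHalf Γ.carrier ≃L[ℝ] HHalf Γ.carrier) : Prop :=
  ∃ α : ℝ, 0 < α ∧ ∀ ψ : HMinusHalf Γ.carrier, α * ‖ψ‖ ^ 2 ≤ ψ (V ψ)

/-- `φ` solves the variational formulation `⟨V φ, ψ⟩ = ⟨f, ψ⟩` for all `ψ ∈ H̃^{-1/2}(Γ)`. -/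
def IsWeakSolution (V : HMinusHalf Γ.carrier ≃L[ℝ] HHalf Γ.carrier) (f : HHalf Γ.carrier)
    (φ : HMinusHalf Γ.carrier) : Prop :=
  ∀ ψ : HMinusHalf Γ.carrier, ψ (V φ) = ψ f

/-- `φ_h` is the Galerkin solution in `X`: `φ_h ∈ X` and
`∫_Γ (V φ_h) ψ_h dx = ∫_Γ f ψ_h dx` for all `ψ_h ∈ X`. -/
def IsGalerkinSolution (V : HMinusHalf Γ.carrier ≃L[ℝ] HHalf Γ.carrier) (f : HHalf Γ.carrier)
    (X : Submodule ℝ (L2 Γ.carrier)) (φh : L2 Γ.carrier) : Prop :=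
  φh ∈ X ∧ ∀ ψh ∈ X, ∫ x, (V (ofL2 φh)).toL2 x * ψh x ∂(arc Γ.carrier) =
    ∫ x, f.toL2 x * ψh x ∂(arc Γ.carrier)

end BoundaryPart

end FaermannBEM

end

/-!
The residual is `r = V (φ - φ_h)`, because functionals separate points of `H^{1/2}(Γ)` and hence
`V φ = f`. As `V` is a linear homeomorphism, `‖φ - φ_h‖` and `‖r‖_{H^{1/2}(Γ)}` are equivalent, and
the theorem says that the norm of `r` can be localized to node patches.

*Efficiency* (`Mesh.faermann_le_norm`) is a matter of overlap: a point of `Γ` lies in at most two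
elements, each of which has two nodes, hence in at most four node patches.

*Reliability* (`Mesh.exists_norm_le_faermann`) uses that `r` is orthogonal to the functions `ψ_T`.

* The geometric input is the chord-arc property (`exists_isChordArc`): the parametrization is
  bi-Lipschitz with respect to the distance along the curve. Locally this holds because the one-sided
  tangents are nonzero and form no cusp; compactness and injectivity make it global. So arclength is
  comparable to parameter length, and integrating `|x - y|⁻²` over points at parameter distance at
  least `δ` from `x` gives at most a multiple of `1 / δ`.
* The double integral in the seminorm on `Γ` is split into pairs of points in neighbouring elements,
  which lie in a common node patch, and the remaining far field. There
  `|r(x) - r(y)|² ≤ 2 |r(x)|² + 2 |r(y)|²`, and by symmetry the far field is bounded by a multiple of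
  `∑_T h_T⁻¹ ‖r‖²_{L²(T)}` (`Mesh.interaction_univ_le`). To leave the patch of `T` one has to pass a
  neighbour of `T`, whose length is comparable to `h_T`.
* If `S = supp ψ_T`, orthogonality and the closeness of `ψ_T` to `1` give
  `q ‖r‖²_{L²(S)} ≤ ‖r - c‖²_{L²(S)}` for every constant `c` (`mul_integral_sq_le_of_orthogonal`).
  A Poincaré inequality on `T` provides a good `c`, and the bound for `r - c` is carried from element
  to element through the patch of order `m` (`Mesh.exists_deviationSq_patchElements_le`). Since each
  element meets at most four elements, summing over `T` costs only a factor `4 ^ m`.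
-/

namespace FaermannBEM

open Filter Topology

/-! ### One-sided strict derivatives and corners -/

section Corner

variable {E : Type*} [NormedAddCommGroup E] [NormedSpace ℝ E]

/-- `f` has the strict derivative `w` at `t` relative to the set `A`: difference quotients between
any two points of `A` close to `t` are close to `w`. With `A = Iic t` or `A = Ici t` this is a
one-sided strict derivative. -/
def HasStrictDerivOn (f : ℝ → E) (A : Set ℝ) (t : ℝ) (w : E) : Prop :=
  ∀ ε : ℝ, 0 < ε → ∃ δ : ℝ, 0 < δ ∧ ∀ s ∈ A, ∀ s' ∈ A, |s - t| ≤ δ → |s' - t| ≤ δ →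
    ‖f s' - f s - (s' - s) • w‖ ≤ ε * |s' - s|

theorem HasStrictDerivOn.mono {f : ℝ → E} {A B : Set ℝ} {t : ℝ} {w : E}
    (h : HasStrictDerivOn f B t w) (hAB : A ⊆ B) : HasStrictDerivOn f A t w := by
  intro ε hε
  obtain ⟨δ, hδ, H⟩ := h ε hε
  exact ⟨δ, hδ, fun s hs s' hs' => H s (hAB hs) s' (hAB hs')⟩

theorem HasStrictDerivOn.of_inter_Icc {f : ℝ → E} {A : Set ℝ} {t η : ℝ} {w : E} (hη : 0 < η)
    (h : HasStrictDerivOn f (A ∩ Icc (t - η) (t + η)) t w) : HasStrictDerivOn f A t w := by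
  intro ε hε
  obtain ⟨δ, hδ, H⟩ := h ε hε
  refine ⟨min δ η, lt_min hδ hη, fun s hs s' hs' h1 h2 => ?_⟩
  have hs1 := abs_le.1 (h1.trans (min_le_right _ _))
  have hs2 := abs_le.1 (h2.trans (min_le_right _ _))
  exact H s ⟨hs, by linarith, by linarith⟩ s' ⟨hs', by linarith, by linarith⟩
    (h1.trans (min_le_left _ _)) (h2.trans (min_le_left _ _))

theorem HasStrictDerivOn.of_subsingleton {f : ℝ → E} {A : Set ℝ} {t : ℝ} {w : E}
    (hA : A.Subsingleton) : HasStrictDerivOn f A t w := by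
  refine fun ε hε => ⟨1, one_pos, fun s hs s' hs' _ _ => ?_⟩
  rw [hA hs hs']
  simp

theorem HasStrictDerivOn.hasDerivWithinAt {f : ℝ → E} {A : Set ℝ} {t : ℝ} {w : E}
    (h : HasStrictDerivOn f A t w) (ht : t ∈ A) : HasDerivWithinAt f w A t := by
  rw [hasDerivWithinAt_iff_isLittleO, Asymptotics.isLittleO_iff]
  intro ε hε
  obtain ⟨δ, hδ, H⟩ := h ε hε
  filter_upwards [self_mem_nhdsWithin, mem_nhdsWithin_of_mem_nhds (Metric.closedBall_mem_nhds t hδ)]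
    with s hs hs'
  exact H t ht s hs (by simpa using hδ.le) hs'

theorem hasStrictDerivOn_of_contDiffOn {f : ℝ → E} {u v t : ℝ} (huv : u < v)
    (hf : ContDiffOn ℝ 2 f (Icc u v)) (ht : t ∈ Icc u v) :
    HasStrictDerivOn f (Icc u v) t (derivWithin f (Icc u v) t) := by
  intro ε hε
  have hc := (hf.continuousOn_derivWithin (uniqueDiffOn_Icc huv) (by norm_num)) t ht
  obtain ⟨δ, hδ, H⟩ := Metric.continuousWithinAt_iff.1 hc ε hε
  refine ⟨δ / 2, by positivity, fun s hs s' hs' h1 h2 => ?_⟩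
  set w := derivWithin f (Icc u v) t
  have hconv : Convex ℝ (Icc u v ∩ Icc (t - δ / 2) (t + δ / 2)) :=
    (convex_Icc _ _).inter (convex_Icc _ _)
  have hd : ∀ x ∈ Icc u v ∩ Icc (t - δ / 2) (t + δ / 2),
      HasDerivWithinAt (fun x => f x - x • w) (derivWithin f (Icc u v) x - w)
        (Icc u v ∩ Icc (t - δ / 2) (t + δ / 2)) x := by
    intro x hx
    have e1 := ((hf.differentiableOn (by norm_num)) x hx.1).hasDerivWithinAt.mono
      (inter_subset_left (t := Icc (t - δ / 2) (t + δ / 2)))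
    have e2 := ((hasDerivAt_id x).smul_const w).hasDerivWithinAt
      (s := Icc u v ∩ Icc (t - δ / 2) (t + δ / 2))
    rw [one_smul] at e2
    exact e1.sub e2
  have hb : ∀ x ∈ Icc u v ∩ Icc (t - δ / 2) (t + δ / 2),
      ‖derivWithin f (Icc u v) x - w‖ ≤ ε := by
    intro x hx
    have hx2 : dist x t < δ := by
      rw [Real.dist_eq]
      exact lt_of_le_of_lt (abs_le.2 ⟨by linarith [hx.2.1], by linarith [hx.2.2]⟩)
        (half_lt_self hδ)
    have := H hx.1 hx2
    rw [dist_eq_norm] at this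
    exact this.le
  have k1 := abs_le.1 h1
  have k2 := abs_le.1 h2
  have := hconv.norm_image_sub_le_of_norm_hasDerivWithin_le hd hb
    (x := s) (y := s') ⟨hs, by linarith, by linarith⟩ ⟨hs', by linarith, by linarith⟩
  rw [Real.norm_eq_abs] at this
  refine le_of_eq_of_le ?_ this
  congr 1
  rw [sub_smul]
  abel

/-- Two nonzero vectors that do not point in opposite directions span a cone on which the norm is
comparable to the sum of the coefficients. -/
theorem exists_cone_lower_bound {wl wr : E} (hl : wl ≠ 0) (hr : wr ≠ 0)
    (hlr : ∀ c : ℝ, 0 < c → wl + c • wr ≠ 0) :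
    ∃ c₀ : ℝ, 0 < c₀ ∧ ∀ α β : ℝ, 0 ≤ α → 0 ≤ β → c₀ * (α + β) ≤ ‖α • wl + β • wr‖ := by
  have hcont : ContinuousOn (fun θ : ℝ => ‖(1 - θ) • wl + θ • wr‖) (Icc 0 1) := by fun_prop
  obtain ⟨θ, hθ, hmin⟩ := isCompact_Icc.exists_isMinOn (nonempty_Icc.2 zero_le_one) hcont
  refine ⟨‖(1 - θ) • wl + θ • wr‖, ?_, fun α β hα hβ => ?_⟩
  · rw [norm_pos_iff]
    rcases hθ.2.eq_or_lt with h1 | h1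
    · simpa [h1] using hr
    rcases hθ.1.eq_or_lt with h0 | h0
    · simpa [← h0] using hl
    · intro h
      refine hlr (θ / (1 - θ)) (div_pos h0 (by linarith)) ?_
      have h2 : (1 - θ) ≠ 0 := by linarith
      have := congrArg (fun x => (1 - θ)⁻¹ • x) h
      simpa [smul_add, smul_smul, h2, div_eq_inv_mul] using this
  · rcases (add_nonneg hα hβ).eq_or_lt with h0 | h0
    · rw [← h0]
      simp
    · have hm := hmin (a := β / (α + β)) ⟨by positivity, (div_le_one h0).2 (by linarith)⟩
      simp only [mem_ofPred_eq] at hm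
      have e : α • wl + β • wr
          = (α + β) • ((1 - β / (α + β)) • wl + (β / (α + β)) • wr) := by
        rw [smul_add, smul_smul, smul_smul]
        congr 2 <;> field_simp
        ring
      rw [e, norm_smul, Real.norm_of_nonneg h0.le, mul_comm]
      exact mul_le_mul_of_nonneg_left hm h0.le

/-- A curve with nonzero one-sided strict derivatives that do not form a cusp is bi-Lipschitz
near the corner. -/
theorem exists_local_biLipschitz {f : ℝ → E} {D : Set ℝ} {t : ℝ} {wl wr : E} (ht : t ∈ D)
    (hl : wl ≠ 0) (hr : wr ≠ 0) (hlr : ∀ c : ℝ, 0 < c → wl + c • wr ≠ 0)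
    (hfl : HasStrictDerivOn f (D ∩ Iic t) t wl) (hfr : HasStrictDerivOn f (D ∩ Ici t) t wr) :
    ∃ c L δ : ℝ, 0 < c ∧ 0 < δ ∧ ∀ s ∈ D, ∀ s' ∈ D, |s - t| ≤ δ → |s' - t| ≤ δ →
      c * |s - s'| ≤ ‖f s - f s'‖ ∧ ‖f s - f s'‖ ≤ L * |s - s'| := by
  obtain ⟨c₀, hc₀, hcone⟩ := exists_cone_lower_bound hl hr hlr
  obtain ⟨δl, hδl, Hl⟩ := hfl (c₀ / 2) (by positivity)
  obtain ⟨δr, hδr, Hr⟩ := hfr (c₀ / 2) (by positivity)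
  have key : ∀ s ∈ D, ∀ s' ∈ D, s ≤ s' → |s - t| ≤ min δl δr → |s' - t| ≤ min δl δr →
      c₀ / 2 * |s - s'| ≤ ‖f s - f s'‖ ∧
        ‖f s - f s'‖ ≤ (‖wl‖ + ‖wr‖ + c₀ / 2) * |s - s'| := by
    intro s hs s' hs' hss h1 h2
    have hmin : ∀ x ∈ D, min x t ∈ D ∩ Iic t := fun x hx =>
      ⟨by rcases min_choice x t with h | h <;> rw [h] <;> assumption, mem_Iic.2 (min_le_right _ _)⟩
    have hmax : ∀ x ∈ D, max x t ∈ D ∩ Ici t := fun x hx =>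
      ⟨by rcases max_choice x t with h | h <;> rw [h] <;> assumption, mem_Ici.2 (le_max_right _ _)⟩
    have hbmin : ∀ x, |min x t - t| ≤ |x - t| := fun x => by
      rcases min_choice x t with h | h <;> simp [h]
    have hbmax : ∀ x, |max x t - t| ≤ |x - t| := fun x => by
      rcases max_choice x t with h | h <;> simp [h]
    have el := Hl _ (hmin s hs) _ (hmin s' hs')
      ((hbmin s).trans (h1.trans (min_le_left _ _)))
      ((hbmin s').trans (h2.trans (min_le_left _ _)))
    have er := Hr _ (hmax s hs) _ (hmax s' hs')
      ((hbmax s).trans (h1.trans (min_le_right _ _)))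
      ((hbmax s').trans (h2.trans (min_le_right _ _)))
    set α := min s' t - min s t with hα
    set β := max s' t - max s t with hβ
    have hα0 : 0 ≤ α := sub_nonneg.2 (min_le_min_right t hss)
    have hβ0 : 0 ≤ β := sub_nonneg.2 (max_le_max_right t hss)
    have hsum : α + β = s' - s := by
      have e1 := min_add_max s t
      have e2 := min_add_max s' t
      linarith
    have hf : ∀ x, f (min x t) + f (max x t) = f x + f t := fun x => by
      rcases le_total x t with h | h
      · rw [min_eq_left h, max_eq_right h]
      · rw [min_eq_right h, max_eq_left h, add_comm]
    rw [abs_of_nonneg hα0] at el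
    rw [abs_of_nonneg hβ0] at er
    have habs : |s - s'| = α + β := by rw [abs_sub_comm, hsum, abs_of_nonneg (by linarith)]
    have herr : ‖(f s' - f s) - (α • wl + β • wr)‖ ≤ c₀ / 2 * (α + β) := by
      have e : (f s' - f s) - (α • wl + β • wr)
          = (f (min s' t) - f (min s t) - α • wl) + (f (max s' t) - f (max s t) - β • wr) := by
        have h1 : f s' = f (min s' t) + f (max s' t) - f t := by rw [hf]; abel
        have h2 : f s = f (min s t) + f (max s t) - f t := by rw [hf]; abel
        rw [h1, h2]
        abel
      rw [e, mul_add]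
      exact (norm_add_le _ _).trans (add_le_add el er)
    have hlow := hcone α β hα0 hβ0
    have hup : ‖α • wl + β • wr‖ ≤ (‖wl‖ + ‖wr‖) * (α + β) := by
      refine (norm_add_le _ _).trans ?_
      rw [norm_smul, norm_smul, Real.norm_of_nonneg hα0, Real.norm_of_nonneg hβ0]
      nlinarith [norm_nonneg wl, norm_nonneg wr, mul_nonneg hα0 (norm_nonneg wr),
        mul_nonneg hβ0 (norm_nonneg wl)]
    have t1 := norm_sub_norm_le (α • wl + β • wr) (f s' - f s)
    rw [norm_sub_rev (α • wl + β • wr)] at t1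
    have t2 := norm_sub_norm_le (f s' - f s) (α • wl + β • wr)
    rw [habs, norm_sub_rev (f s)]
    constructor <;> linarith
  refine ⟨c₀ / 2, ‖wl‖ + ‖wr‖ + c₀ / 2, min δl δr, by positivity, lt_min hδl hδr,
    fun s hs s' hs' h1 h2 => ?_⟩
  rcases le_total s s' with h | h
  · exact key s hs s' hs' h h1 h2
  · have := key s' hs' s hs h h2 h1
    rwa [abs_sub_comm, norm_sub_rev] at this

end Corner

/-! ### Partitions of an interval -/

theorem exists_mem_Ioc_of_partition {N : ℕ} (z : Fin (N + 1) → ℝ) {s : ℝ} (h0 : z 0 < s)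
    (hN : s ≤ z (Fin.last N)) : ∃ i : Fin N, s ∈ Ioc (z i.castSucc) (z i.succ) := by
  have hex : ∀ k : Fin (N + 1), s ≤ z k → ∃ i : Fin N, s ∈ Ioc (z i.castSucc) (z i.succ) := by
    intro k
    induction k using Fin.induction with
    | zero => exact fun h => absurd h (not_le.2 h0)
    | succ i ih =>
      intro h
      by_cases h' : s ≤ z i.castSucc
      · exact ih h'
      · exact ⟨i, not_le.1 h', h⟩
  exact hex _ hN

theorem exists_mem_Ico_of_partition {N : ℕ} (z : Fin (N + 1) → ℝ) {s : ℝ} (h0 : z 0 ≤ s)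
    (hN : s < z (Fin.last N)) : ∃ i : Fin N, s ∈ Ico (z i.castSucc) (z i.succ) := by
  have hex : ∀ k : Fin (N + 1), s < z k → ∃ i : Fin N, s ∈ Ico (z i.castSucc) (z i.succ) := by
    intro k
    induction k using Fin.induction with
    | zero => exact fun h => absurd h (not_lt.2 h0)
    | succ i ih =>
      intro h
      by_cases h' : s < z i.castSucc
      · exact ih h'
      · exact ⟨i, not_lt.1 h', h⟩
  exact hex _ hN

/-! ### The chord-arc property of the curve -/

namespace BoundaryPart

variable (Γ : BoundaryPart)

/-- The parameters for which `γ` parametrizes `Γ`: the whole line for a closed curve (periodic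
extension) and `[a, b]` for an arc. -/
def domain : Set ℝ := {t | Γ.IsClosedCurve ∨ t ∈ Icc Γ.a Γ.b}

theorem Icc_subset_domain : Icc Γ.a Γ.b ⊆ Γ.domain := fun _ ht => Or.inr ht

variable {Γ} in
theorem domain_of_closed (h : Γ.IsClosedCurve) : Γ.domain = univ :=
  eq_univ_of_forall fun _ => Or.inl h

variable {Γ} in
theorem domain_of_open (h : ¬ Γ.IsClosedCurve) : Γ.domain = Icc Γ.a Γ.b :=
  ext fun _ => ⟨fun ht => ht.resolve_left h, Or.inr⟩

theorem isClosed_domain : IsClosed Γ.domain := by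
  by_cases h : Γ.IsClosedCurve
  · simp [domain_of_closed h]
  · simpa [domain_of_open h] using isClosed_Icc

theorem γ_add_zsmul (h : Γ.IsClosedCurve) (t : ℝ) (k : ℤ) :
    Γ.γ (t + k * (Γ.b - Γ.a)) = Γ.γ t := by
  simpa using ((Γ.periodic h).zsmul k) t

theorem hasStrictDerivOn_right {t : ℝ} (ht : t ∈ Ico Γ.a Γ.b) :
    HasStrictDerivOn Γ.γ (Ici t) t (derivWithin Γ.γ (Ici t) t) := by
  obtain ⟨-, N, z, hmono, h0, hN, hsm⟩ := Γ.piecewise_smooth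
  obtain ⟨i, hi⟩ := exists_mem_Ico_of_partition z (h0 ▸ ht.1) (hN ▸ ht.2)
  have hlt : z i.castSucc < z i.succ := hmono Fin.castSucc_lt_succ
  have h1 : HasStrictDerivOn Γ.γ (Ici t) t (derivWithin Γ.γ (Icc (z i.castSucc) (z i.succ)) t) := by
    refine HasStrictDerivOn.of_inter_Icc (sub_pos.2 hi.2)
      ((hasStrictDerivOn_of_contDiffOn hlt (hsm i) ⟨hi.1, hi.2.le⟩).mono ?_)
    exact fun s hs => ⟨hi.1.trans hs.1, by linarith [hs.2.2]⟩
  rwa [(h1.hasDerivWithinAt self_mem_Ici).derivWithin (uniqueDiffWithinAt_Ici t)]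

theorem hasStrictDerivOn_left {t : ℝ} (ht : t ∈ Ioc Γ.a Γ.b) :
    HasStrictDerivOn Γ.γ (Iic t) t (derivWithin Γ.γ (Iic t) t) := by
  obtain ⟨-, N, z, hmono, h0, hN, hsm⟩ := Γ.piecewise_smooth
  obtain ⟨i, hi⟩ := exists_mem_Ioc_of_partition z (h0 ▸ ht.1) (hN ▸ ht.2)
  have hlt : z i.castSucc < z i.succ := hmono Fin.castSucc_lt_succ
  have h1 : HasStrictDerivOn Γ.γ (Iic t) t (derivWithin Γ.γ (Icc (z i.castSucc) (z i.succ)) t) := by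
    refine HasStrictDerivOn.of_inter_Icc (sub_pos.2 hi.1)
      ((hasStrictDerivOn_of_contDiffOn hlt (hsm i) ⟨hi.1.le, hi.2⟩).mono ?_)
    exact fun s hs => ⟨by linarith [hs.2.1], le_trans hs.1 hi.2⟩
  rwa [(h1.hasDerivWithinAt self_mem_Iic).derivWithin (uniqueDiffWithinAt_Iic t)]

/-- One-sided tangents at a parameter in `[a, b]`. At an end point of an arc, where one side is
missing, the tangent of the other side serves for both. -/
theorem exists_corner {t : ℝ} (ht : t ∈ Icc Γ.a Γ.b) :
    ∃ wl wr : Plane, wl ≠ 0 ∧ wr ≠ 0 ∧ (∀ c : ℝ, 0 < c → wl + c • wr ≠ 0) ∧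
      HasStrictDerivOn Γ.γ (Γ.domain ∩ Iic t) t wl ∧
      HasStrictDerivOn Γ.γ (Γ.domain ∩ Ici t) t wr := by
  have hself : ∀ w : Plane, w ≠ 0 → ∀ c : ℝ, 0 < c → w + c • w ≠ 0 := by
    intro w hw c hc h
    have : (1 + c) • w = 0 := by rw [add_smul, one_smul, h]
    rcases smul_eq_zero.1 this with h' | h'
    · linarith
    · exact hw h'
  by_cases hcl : Γ.IsClosedCurve
  · have hp := Γ.periodic hcl
    -- the seam `γ a = γ b` is the parameter `b`, where the periodic extension supplies the right side
    have main : ∀ t ∈ Ioc Γ.a Γ.b, derivWithin Γ.γ (Iic t) t ≠ 0 ∧ derivWithin Γ.γ (Ici t) t ≠ 0 ∧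
        HasStrictDerivOn Γ.γ (Iic t) t (derivWithin Γ.γ (Iic t) t) ∧
        HasStrictDerivOn Γ.γ (Ici t) t (derivWithin Γ.γ (Ici t) t) := by
      intro t ht
      rcases ht.2.eq_or_lt with hb | hb
      · have ha : Γ.a ∈ Ico Γ.a Γ.b := ⟨le_rfl, Γ.a_lt_b⟩
        have h1 : HasStrictDerivOn Γ.γ (Ici t) t (derivWithin Γ.γ (Ici Γ.a) Γ.a) := by
          intro ε hε
          obtain ⟨δ, hδ, H⟩ := Γ.hasStrictDerivOn_right ha ε hε
          refine ⟨δ, hδ, fun s hs s' hs' k1 k2 => ?_⟩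
          have := H (s - (Γ.b - Γ.a)) (by simp only [mem_Ici] at *; linarith)
            (s' - (Γ.b - Γ.a)) (by simp only [mem_Ici] at *; linarith)
            (by rw [hb] at k1; convert k1 using 2; ring)
            (by rw [hb] at k2; convert k2 using 2; ring)
          rw [hp.sub_eq, hp.sub_eq, sub_sub_sub_cancel_right] at this
          exact this
        have h2 := (h1.hasDerivWithinAt self_mem_Ici).derivWithin (uniqueDiffWithinAt_Ici t)
        rw [h2]
        exact ⟨Γ.left_deriv_ne_zero t ht, Γ.right_deriv_ne_zero _ ha,
          Γ.hasStrictDerivOn_left ht, h1⟩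
      · exact ⟨Γ.left_deriv_ne_zero t ht, Γ.right_deriv_ne_zero t ⟨ht.1.le, hb⟩,
          Γ.hasStrictDerivOn_left ht, Γ.hasStrictDerivOn_right ⟨ht.1.le, hb⟩⟩
    rcases ht.1.eq_or_lt with ha | ha
    · have hb : Γ.b ∈ Ioc Γ.a Γ.b := ⟨Γ.a_lt_b, le_rfl⟩
      obtain ⟨h1, h2, h3, h4⟩ := main _ hb
      have shift : ∀ {A B : Set ℝ} {w : Plane}, HasStrictDerivOn Γ.γ B Γ.b w →
          (∀ s ∈ A, s + (Γ.b - Γ.a) ∈ B) → HasStrictDerivOn Γ.γ A t w := by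
        intro A B w h hAB ε hε
        obtain ⟨δ, hδ, H⟩ := h ε hε
        refine ⟨δ, hδ, fun s hs s' hs' k1 k2 => ?_⟩
        have := H _ (hAB s hs) _ (hAB s' hs') (by rw [← ha] at k1; convert k1 using 2; ring)
          (by rw [← ha] at k2; convert k2 using 2; ring)
        rw [hp, hp, add_sub_add_right_eq_sub] at this
        exact this
      refine ⟨_, _, h1, h2, Γ.no_cusp _ ⟨hb.1.le, hb.2⟩ (Or.inl hcl), shift h3 ?_, shift h4 ?_⟩
      · intro s hs
        have := hs.2
        simp only [mem_Iic] at *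
        linarith
      · intro s hs
        have := hs.2
        simp only [mem_Ici] at *
        linarith
    · obtain ⟨h1, h2, h3, h4⟩ := main t ⟨ha, ht.2⟩
      exact ⟨_, _, h1, h2, Γ.no_cusp t ht (Or.inl hcl), h3.mono inter_subset_right,
        h4.mono inter_subset_right⟩
  · rw [domain_of_open hcl]
    rcases ht.1.eq_or_lt with ha | ha
    · have hr := Γ.right_deriv_ne_zero t ⟨ht.1, ha ▸ Γ.a_lt_b⟩
      refine ⟨_, _, hr, hr, hself _ hr, HasStrictDerivOn.of_subsingleton ?_,
        (Γ.hasStrictDerivOn_right ⟨ht.1, ha ▸ Γ.a_lt_b⟩).mono inter_subset_right⟩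
      rintro x ⟨hx, hx'⟩ y ⟨hy, hy'⟩
      simp only [mem_Iic, mem_Icc] at *
      linarith
    rcases ht.2.eq_or_lt with hb | hb
    · have hl := Γ.left_deriv_ne_zero t ⟨ha, ht.2⟩
      refine ⟨_, _, hl, hl, hself _ hl,
        (Γ.hasStrictDerivOn_left ⟨ha, ht.2⟩).mono inter_subset_right,
        HasStrictDerivOn.of_subsingleton ?_⟩
      rintro x ⟨hx, hx'⟩ y ⟨hy, hy'⟩
      simp only [mem_Ici, mem_Icc] at *
      linarith
    · exact ⟨_, _, Γ.left_deriv_ne_zero t ⟨ha, ht.2⟩, Γ.right_deriv_ne_zero t ⟨ht.1, hb⟩,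
        Γ.no_cusp t ht (Or.inr ⟨ha, hb⟩),
        (Γ.hasStrictDerivOn_left ⟨ha, ht.2⟩).mono inter_subset_right,
        (Γ.hasStrictDerivOn_right ⟨ht.1, hb⟩).mono inter_subset_right⟩

theorem exists_int_abs_sub_le (s t : ℝ) :
    ∃ k : ℤ, |s - t - k * (Γ.b - Γ.a)| ≤ (Γ.b - Γ.a) / 2 := by
  have hp : 0 < Γ.b - Γ.a := sub_pos.2 Γ.a_lt_b
  refine ⟨round ((s - t) / (Γ.b - Γ.a)), ?_⟩
  have h := abs_sub_round ((s - t) / (Γ.b - Γ.a))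
  have e : s - t - round ((s - t) / (Γ.b - Γ.a)) * (Γ.b - Γ.a)
      = ((s - t) / (Γ.b - Γ.a) - round ((s - t) / (Γ.b - Γ.a))) * (Γ.b - Γ.a) := by
    field_simp
  rw [e, abs_mul, abs_of_pos hp]
  nlinarith

theorem exists_int_mem_Ico (s : ℝ) : ∃ k : ℤ, s + k * (Γ.b - Γ.a) ∈ Ico Γ.a Γ.b := by
  have hp : 0 < Γ.b - Γ.a := sub_pos.2 Γ.a_lt_b
  obtain ⟨k, hk, -⟩ := existsUnique_add_zsmul_mem_Ico hp s Γ.a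
  exact ⟨k, by simpa using hk⟩

theorem γ_ne_of_abs_sub_le {s t : ℝ} (hs : s ∈ Γ.domain) (ht : t ∈ Γ.domain) (hst : s ≠ t)
    (h : Γ.IsClosedCurve → |s - t| ≤ (Γ.b - Γ.a) / 2) : Γ.γ s ≠ Γ.γ t := by
  intro heq
  have hp : 0 < Γ.b - Γ.a := sub_pos.2 Γ.a_lt_b
  by_cases hcl : Γ.IsClosedCurve
  · obtain ⟨k, hk⟩ := Γ.exists_int_mem_Ico s
    obtain ⟨l, hl⟩ := Γ.exists_int_mem_Ico t
    have := Γ.injOn_closed hcl hk hl (by rw [Γ.γ_add_zsmul hcl, Γ.γ_add_zsmul hcl, heq])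
    have e : s - t = ((l - k : ℤ) : ℝ) * (Γ.b - Γ.a) := by push_cast; linarith
    have h' := h hcl
    rw [e, abs_mul, abs_of_pos hp] at h'
    have hne : l - k ≠ 0 := by
      intro h0
      rw [h0] at e
      exact hst (by simpa [sub_eq_zero] using e)
    have : (1 : ℝ) ≤ |((l - k : ℤ) : ℝ)| := by exact_mod_cast Int.one_le_abs hne
    nlinarith
  · rw [domain_of_open hcl] at hs ht
    exact hst (Γ.injOn_open hcl hs ht heq)

theorem continuousOn_domain : ContinuousOn Γ.γ Γ.domain := by
  by_cases hcl : Γ.IsClosedCurve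
  · have hp : 0 < Γ.b - Γ.a := sub_pos.2 Γ.a_lt_b
    have h0 : ∀ t ∈ Icc Γ.a Γ.b, ContinuousAt Γ.γ t := by
      intro t ht
      obtain ⟨wl, wr, -, -, -, hl, hr⟩ := Γ.exists_corner ht
      have htd : t ∈ Γ.domain := Γ.Icc_subset_domain ht
      have c1 := (hl.hasDerivWithinAt ⟨htd, self_mem_Iic⟩).continuousWithinAt
      have c2 := (hr.hasDerivWithinAt ⟨htd, self_mem_Ici⟩).continuousWithinAt
      have := c1.union c2
      rw [← inter_union_distrib_left, Iic_union_Ici, inter_univ] at this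
      simpa [domain_of_closed hcl, continuousWithinAt_univ] using this
    refine (continuous_iff_continuousAt.2 fun t => ?_).continuousOn
    obtain ⟨k, hk⟩ := Γ.exists_int_mem_Ico t
    have e : Γ.γ = Γ.γ ∘ fun s => s + k * (Γ.b - Γ.a) := by
      ext1 s
      exact (Γ.γ_add_zsmul hcl s k).symm
    rw [e]
    exact ContinuousAt.comp (h0 _ ⟨hk.1, hk.2.le⟩) (by fun_prop)
  · simpa [domain_of_open hcl] using Γ.piecewise_smooth.1

/-- The chord-arc property with constants `c` and `L`: on parameters at distance at most one period
`γ` is Lipschitz, and it is bi-Lipschitz as long as the parameter distance is the distance along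
the curve. -/
structure IsChordArc (c L : ℝ) : Prop where
  c_pos : 0 < c
  L_pos : 0 < L
  upper : ∀ s ∈ Γ.domain, ∀ t ∈ Γ.domain, |s - t| ≤ Γ.b - Γ.a → ‖Γ.γ s - Γ.γ t‖ ≤ L * |s - t|
  lower : ∀ s ∈ Γ.domain, ∀ t ∈ Γ.domain, (Γ.IsClosedCurve → |s - t| ≤ (Γ.b - Γ.a) / 2) →
    c * |s - t| ≤ ‖Γ.γ s - Γ.γ t‖

/-- The curve has the chord-arc property. Near the diagonal this is the local statement at a corner,
away from it injectivity; compactness does the rest. -/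
theorem exists_isChordArc : ∃ c L : ℝ, Γ.IsChordArc c L := by
  have hp : 0 < Γ.b - Γ.a := sub_pos.2 Γ.a_lt_b
  set K : Set (ℝ × ℝ) := {q | q.1 ∈ Γ.domain ∧ q.2 ∈ Icc Γ.a Γ.b ∧ |q.1 - q.2| ≤ Γ.b - Γ.a}
    with hK
  have hKc : IsCompact K := by
    refine (isCompact_Icc (a := Γ.a - (Γ.b - Γ.a)) (b := Γ.b + (Γ.b - Γ.a))).prod
      (isCompact_Icc (a := Γ.a) (b := Γ.b)) |>.of_isClosed_subset ?_ ?_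
    · refine (Γ.isClosed_domain.preimage continuous_fst).inter
        ((isClosed_Icc.preimage continuous_snd).inter ?_)
      exact isClosed_le (continuous_fst.sub continuous_snd).abs continuous_const
    · rintro q ⟨-, h2, h3⟩
      have := abs_le.1 h3
      exact ⟨⟨by linarith [h2.1], by linarith [h2.2]⟩, h2⟩
  have hmain : ∃ c L : ℝ, 0 < c ∧ ∀ q ∈ K, ‖Γ.γ q.1 - Γ.γ q.2‖ ≤ L * |q.1 - q.2| ∧
      ((Γ.IsClosedCurve → |q.1 - q.2| ≤ (Γ.b - Γ.a) / 2) →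
        c * |q.1 - q.2| ≤ ‖Γ.γ q.1 - Γ.γ q.2‖) := by
    refine hKc.induction_on (p := fun S => ∃ c L : ℝ, 0 < c ∧ ∀ q ∈ S,
      ‖Γ.γ q.1 - Γ.γ q.2‖ ≤ L * |q.1 - q.2| ∧
      ((Γ.IsClosedCurve → |q.1 - q.2| ≤ (Γ.b - Γ.a) / 2) →
        c * |q.1 - q.2| ≤ ‖Γ.γ q.1 - Γ.γ q.2‖)) ?_ ?_ ?_ ?_
    · exact ⟨1, 1, one_pos, fun q hq => hq.elim⟩
    · rintro S S' hSS ⟨c, L, hc, H⟩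
      exact ⟨c, L, hc, fun q hq => H q (hSS hq)⟩
    · rintro S S' ⟨c, L, hc, H⟩ ⟨c', L', hc', H'⟩
      refine ⟨min c c', max L L', lt_min hc hc', ?_⟩
      rintro q (hq | hq)
      · exact ⟨(H q hq).1.trans (by gcongr; exact le_max_left _ _), fun h =>
          le_trans (by gcongr; exact min_le_left _ _) ((H q hq).2 h)⟩
      · exact ⟨(H' q hq).1.trans (by gcongr; exact le_max_right _ _), fun h =>
          le_trans (by gcongr; exact min_le_right _ _) ((H' q hq).2 h)⟩
    · rintro ⟨s, t⟩ ⟨hs, ht, hst⟩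
      simp only at hs ht hst
      have htd : t ∈ Γ.domain := Γ.Icc_subset_domain ht
      rcases eq_or_ne s t with rfl | hne
      · obtain ⟨wl, wr, h1, h2, h3, h4, h5⟩ := Γ.exists_corner ht
        obtain ⟨c, L, δ, hc, hδ, H⟩ := exists_local_biLipschitz htd h1 h2 h3 h4 h5
        refine ⟨K ∩ (Metric.closedBall s δ ×ˢ Metric.closedBall s δ), inter_mem_nhdsWithin _
          (prod_mem_nhds (Metric.closedBall_mem_nhds s hδ) (Metric.closedBall_mem_nhds s hδ)),
          c, L, hc, ?_⟩
        rintro q ⟨hq, hq1, hq2⟩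
        have := H q.1 hq.1 q.2 (Γ.Icc_subset_domain hq.2.1) hq1 hq2
        exact ⟨this.2, fun _ => this.1⟩
      · have hc1 : ContinuousOn (fun q : ℝ × ℝ => ‖Γ.γ q.1 - Γ.γ q.2‖ / |q.1 - q.2|)
            (K ∩ {q | q.1 ≠ q.2}) := by
          refine ContinuousOn.div (ContinuousOn.norm (ContinuousOn.sub ?_ ?_)) (by fun_prop) ?_
          · exact Γ.continuousOn_domain.comp continuousOn_fst fun q hq => hq.1.1
          · exact Γ.continuousOn_domain.comp continuousOn_snd
              fun q hq => Γ.Icc_subset_domain hq.1.2.1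
          · intro q hq
            simpa [sub_eq_zero] using hq.2
        have hopen : {q : ℝ × ℝ | q.1 ≠ q.2} ∈ 𝓝 (s, t) :=
          (isOpen_ne_fun continuous_fst continuous_snd).mem_nhds hne
        have hc2 : ContinuousWithinAt (fun q : ℝ × ℝ => ‖Γ.γ q.1 - Γ.γ q.2‖ / |q.1 - q.2|)
            K (s, t) := by
          have := hc1 (s, t) ⟨⟨hs, ht, hst⟩, hne⟩
          rwa [continuousWithinAt_inter hopen] at this
        set R := ‖Γ.γ s - Γ.γ t‖ / |s - t| with hR
        have hdpos : 0 < |s - t| := abs_pos.2 (sub_ne_zero.2 hne)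
        by_cases hclose : Γ.IsClosedCurve → |s - t| ≤ (Γ.b - Γ.a) / 2
        · have hRpos : 0 < R :=
            div_pos (norm_pos_iff.2 (sub_ne_zero.2 (Γ.γ_ne_of_abs_sub_le hs htd hne hclose))) hdpos
          refine ⟨K ∩ ({q | R / 2 < ‖Γ.γ q.1 - Γ.γ q.2‖ / |q.1 - q.2|} ∩
            {q | ‖Γ.γ q.1 - Γ.γ q.2‖ / |q.1 - q.2| < R + 1} ∩ {q | q.1 ≠ q.2}),
            inter_mem self_mem_nhdsWithin (inter_mem (inter_mem
              (hc2 (lt_mem_nhds (half_lt_self hRpos))) (hc2 (gt_mem_nhds (lt_add_one R))))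
              (mem_nhdsWithin_of_mem_nhds hopen)), R / 2, R + 1, by positivity, ?_⟩
          rintro q ⟨-, ⟨h1, h2⟩, h3⟩
          have hq : 0 < |q.1 - q.2| := abs_pos.2 (sub_ne_zero.2 h3)
          exact ⟨((div_lt_iff₀ hq).1 h2).le, fun _ => ((lt_div_iff₀ hq).1 h1).le⟩
        · rw [Classical.not_imp, not_le] at hclose
          refine ⟨K ∩ ({q | (Γ.b - Γ.a) / 2 < |q.1 - q.2|} ∩
            {q | ‖Γ.γ q.1 - Γ.γ q.2‖ / |q.1 - q.2| < R + 1} ∩ {q | q.1 ≠ q.2}),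
            inter_mem self_mem_nhdsWithin (inter_mem (inter_mem
              (mem_nhdsWithin_of_mem_nhds ((isOpen_lt continuous_const
                (by fun_prop)).mem_nhds hclose.2))
              (hc2 (gt_mem_nhds (lt_add_one R))))
              (mem_nhdsWithin_of_mem_nhds hopen)), 1, R + 1, one_pos, ?_⟩
          rintro q ⟨-, ⟨h1, h2⟩, h3⟩
          have hq : 0 < |q.1 - q.2| := abs_pos.2 (sub_ne_zero.2 h3)
          exact ⟨((div_lt_iff₀ hq).1 h2).le, fun h => absurd (h hclose.1) (not_le.2 h1)⟩
  obtain ⟨c, L, hc, H⟩ := hmain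
  -- a common shift by periods moves any pair of parameters into `K`
  have hshift : ∀ s ∈ Γ.domain, ∀ t ∈ Γ.domain, |s - t| ≤ Γ.b - Γ.a →
      ∃ q ∈ K, Γ.γ q.1 = Γ.γ s ∧ Γ.γ q.2 = Γ.γ t ∧ q.1 - q.2 = s - t := by
    intro s hs t ht h
    by_cases hcl : Γ.IsClosedCurve
    · obtain ⟨k, hk⟩ := Γ.exists_int_mem_Ico t
      refine ⟨(s + k * (Γ.b - Γ.a), t + k * (Γ.b - Γ.a)),
        ⟨Or.inl hcl, ⟨hk.1, hk.2.le⟩, by simpa using h⟩, Γ.γ_add_zsmul hcl s k,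
        Γ.γ_add_zsmul hcl t k, by simp⟩
    · exact ⟨(s, t), ⟨hs, by rwa [domain_of_open hcl] at ht, h⟩, rfl, rfl, rfl⟩
  refine ⟨c, max L 1, hc, by positivity, fun s hs t ht h => ?_, fun s hs t ht h => ?_⟩
  · obtain ⟨q, hq, e1, e2, e3⟩ := hshift s hs t ht h
    have := (H q hq).1
    rw [e1, e2, e3] at this
    exact this.trans (by gcongr; exact le_max_left _ _)
  · have h' : |s - t| ≤ Γ.b - Γ.a := by
      by_cases hcl : Γ.IsClosedCurve
      · linarith [h hcl]
      · rw [domain_of_open hcl] at hs ht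
        exact abs_le.2 ⟨by linarith [hs.1, ht.2], by linarith [hs.2, ht.1]⟩
    obtain ⟨q, hq, e1, e2, e3⟩ := hshift s hs t ht h'
    have := (H q hq).2
    rw [e1, e2, e3] at this
    exact this h

/-! ### Arclength in terms of the parameter -/

/-- The parameters whose distance from `t` is the distance along the curve: one full period centered
at `t` for a closed curve, all of `[a, b]` for an arc. -/
def window (t : ℝ) : Set ℝ :=
  {s | s ∈ Γ.domain ∧ (Γ.IsClosedCurve → |s - t| ≤ (Γ.b - Γ.a) / 2)}

theorem window_subset_domain (t : ℝ) : Γ.window t ⊆ Γ.domain := fun _ hs => hs.1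

theorem isClosed_window (t : ℝ) : IsClosed (Γ.window t) := by
  by_cases h : Γ.IsClosedCurve
  · have : Γ.window t = Γ.domain ∩ {s | |s - t| ≤ (Γ.b - Γ.a) / 2} := by
      ext s
      simp [window, h]
    rw [this]
    exact Γ.isClosed_domain.inter
      (isClosed_le (continuous_id.sub continuous_const).abs continuous_const)
  · have : Γ.window t = Γ.domain := by
      ext s
      simp [window, h]
    rw [this]
    exact Γ.isClosed_domain

theorem abs_sub_le_of_mem_window {t s s' : ℝ} (hs : s ∈ Γ.window t) (hs' : s' ∈ Γ.window t) :
    |s - s'| ≤ Γ.b - Γ.a := by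
  by_cases h : Γ.IsClosedCurve
  · have h1 := abs_le.1 (hs.2 h)
    have h2 := abs_le.1 (hs'.2 h)
    exact abs_le.2 ⟨by linarith, by linarith⟩
  · have h1 := hs.1
    have h2 := hs'.1
    rw [domain_of_open h] at h1 h2
    exact abs_le.2 ⟨by linarith [h1.1, h2.2], by linarith [h1.2, h2.1]⟩

theorem exists_mem_Icc_γ_eq {s : ℝ} (hs : s ∈ Γ.domain) : ∃ u ∈ Icc Γ.a Γ.b, Γ.γ u = Γ.γ s := by
  by_cases h : Γ.IsClosedCurve
  · obtain ⟨k, hk⟩ := Γ.exists_int_mem_Ico s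
    exact ⟨_, ⟨hk.1, hk.2.le⟩, Γ.γ_add_zsmul h s k⟩
  · rw [domain_of_open h] at hs
    exact ⟨s, hs, rfl⟩

theorem γ_mem_carrier {s : ℝ} (hs : s ∈ Γ.domain) : Γ.γ s ∈ Γ.carrier := Γ.exists_mem_Icc_γ_eq hs

theorem carrier_subset_image_window (t : ℝ) : Γ.carrier ⊆ Γ.γ '' Γ.window t := by
  rintro _ ⟨u, hu, rfl⟩
  by_cases h : Γ.IsClosedCurve
  · obtain ⟨k, hk⟩ := Γ.exists_int_abs_sub_le u t
    refine ⟨u + ((-k : ℤ) : ℝ) * (Γ.b - Γ.a), ⟨Or.inl h, fun _ => ?_⟩, Γ.γ_add_zsmul h u (-k)⟩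
    convert hk using 2
    push_cast
    ring
  · exact ⟨u, ⟨Or.inr hu, fun h' => absurd h' h⟩, rfl⟩

theorem isCompact_image_Icc {u v : ℝ} (h : Icc u v ⊆ Γ.domain) : IsCompact (Γ.γ '' Icc u v) :=
  isCompact_Icc.image_of_continuousOn (Γ.continuousOn_domain.mono h)

theorem isCompact_carrier : IsCompact Γ.carrier := Γ.isCompact_image_Icc Γ.Icc_subset_domain

variable {Γ} {c L : ℝ} (hΓ : Γ.IsChordArc c L)

include hΓ

theorem IsChordArc.lipschitzOnWith {S : Set ℝ} (hS : S ⊆ Γ.domain)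
    (hd : ∀ s ∈ S, ∀ t ∈ S, |s - t| ≤ Γ.b - Γ.a) : LipschitzOnWith L.toNNReal Γ.γ S := by
  refine LipschitzOnWith.of_dist_le_mul fun s hs t ht => ?_
  rw [dist_eq_norm, Real.dist_eq, Real.coe_toNNReal _ hΓ.L_pos.le]
  exact hΓ.upper s (hS hs) t (hS ht) (hd s hs t ht)

theorem IsChordArc.hausdorffMeasure_image_le {S : Set ℝ} (hS : S ⊆ Γ.domain)
    (hd : ∀ s ∈ S, ∀ t ∈ S, |s - t| ≤ Γ.b - Γ.a) :
    Measure.hausdorffMeasure 1 (Γ.γ '' S) ≤ ENNReal.ofReal L * volume S := by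
  have h := (hΓ.lipschitzOnWith hS hd).hausdorffMeasure_image_le zero_le_one
  rw [hausdorffMeasure_real, ENNReal.rpow_one] at h
  exact h

theorem IsChordArc.le_hausdorffMeasure_image {S : Set ℝ} (hS : S ⊆ Γ.domain)
    (hd : ∀ s ∈ S, ∀ t ∈ S, |s - t| ≤ (Γ.b - Γ.a) / 2) :
    ENNReal.ofReal c * volume S ≤ Measure.hausdorffMeasure 1 (Γ.γ '' S) := by
  have hc := hΓ.c_pos
  have hlow : ∀ s ∈ S, ∀ t ∈ S, c * |s - t| ≤ ‖Γ.γ s - Γ.γ t‖ :=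
    fun s hs t ht => hΓ.lower s (hS hs) t (hS ht) fun _ => hd s hs t ht
  have hinj : InjOn Γ.γ S := by
    intro s hs t ht h
    have := hlow s hs t ht
    rw [h, sub_self, norm_zero] at this
    have h0 : |s - t| ≤ 0 := by
      by_contra h'
      nlinarith [mul_pos hc (not_le.1 h')]
    exact sub_eq_zero.1 (abs_eq_zero.1 (le_antisymm h0 (abs_nonneg _)))
  have hlip : LipschitzOnWith (c⁻¹).toNNReal (Function.invFunOn Γ.γ S) (Γ.γ '' S) := by
    refine LipschitzOnWith.of_dist_le_mul ?_
    rintro _ ⟨s, hs, rfl⟩ _ ⟨t, ht, rfl⟩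
    rw [hinj.leftInvOn_invFunOn hs, hinj.leftInvOn_invFunOn ht, Real.coe_toNNReal _ (by positivity),
      dist_eq_norm (Γ.γ s), Real.dist_eq]
    have := hlow s hs t ht
    rw [inv_mul_eq_div, le_div_iff₀ hc, mul_comm]
    exact this
  have h := hlip.hausdorffMeasure_image_le zero_le_one
  rw [hinj.invFunOn_image subset_rfl, hausdorffMeasure_real, ENNReal.rpow_one] at h
  calc ENNReal.ofReal c * volume S
      ≤ ENNReal.ofReal c * (ENNReal.ofReal c⁻¹ * Measure.hausdorffMeasure 1 (Γ.γ '' S)) := by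
        gcongr
        exact h
    _ = Measure.hausdorffMeasure 1 (Γ.γ '' S) := by
        rw [← mul_assoc, ← ENNReal.ofReal_mul hc.le, mul_inv_cancel₀ hc.ne', ENNReal.ofReal_one,
          one_mul]

theorem IsChordArc.arclength_image_Icc_le {u v : ℝ} (huv : u ≤ v) (h : Icc u v ⊆ Γ.domain)
    (hp : v - u ≤ Γ.b - Γ.a) : arclength (Γ.γ '' Icc u v) ≤ L * (v - u) := by
  have h1 := hΓ.hausdorffMeasure_image_le h fun s hs t ht =>
    abs_le.2 ⟨by linarith [hs.1, ht.2], by linarith [hs.2, ht.1]⟩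
  rw [Real.volume_Icc, ← ENNReal.ofReal_mul hΓ.L_pos.le] at h1
  rw [arclength, arc, Measure.restrict_apply_univ]
  exact ENNReal.toReal_le_of_le_ofReal (mul_nonneg hΓ.L_pos.le (by linarith)) h1

/-- Only parameter intervals up to half a period are mapped in a bi-Lipschitz way, whence the
factor `1 / 2`. -/
theorem IsChordArc.le_arclength_image_Icc {u v : ℝ} (huv : u ≤ v) (h : Icc u v ⊆ Γ.domain)
    (hp : v - u ≤ Γ.b - Γ.a) : c / 2 * (v - u) ≤ arclength (Γ.γ '' Icc u v) := by
  have hc := hΓ.c_pos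
  have hsub : Icc u (u + (v - u) / 2) ⊆ Icc u v := Icc_subset_Icc_right (by linarith)
  have h1 := hΓ.le_hausdorffMeasure_image (hsub.trans h) fun s hs t ht =>
    abs_le.2 ⟨by linarith [hs.1, ht.2], by linarith [hs.2, ht.1]⟩
  have h2 := hΓ.hausdorffMeasure_image_le h fun s hs t ht =>
    abs_le.2 ⟨by linarith [hs.1, ht.2], by linarith [hs.2, ht.1]⟩
  rw [Real.volume_Icc, ← ENNReal.ofReal_mul hc.le, add_sub_cancel_left] at h1
  rw [arclength, arc, Measure.restrict_apply_univ]
  refine (ENNReal.ofReal_le_iff_le_toReal (ne_top_of_le_ne_top (by simp [ENNReal.mul_eq_top]) h2)).1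
    (le_trans (le_of_eq ?_) (h1.trans (measure_mono (image_mono hsub))))
  congr 1
  ring

theorem IsChordArc.arc_le_map (t : ℝ) :
    arc Γ.carrier ≤ ENNReal.ofReal L • (volume.restrict (Γ.window t)).map Γ.γ := by
  have hm : AEMeasurable Γ.γ (volume.restrict (Γ.window t)) :=
    (Γ.continuousOn_domain.mono (Γ.window_subset_domain t)).aemeasurable
      (Γ.isClosed_window t).measurableSet
  refine Measure.le_intro fun E hE _ => ?_
  rw [Measure.smul_apply, smul_eq_mul, Measure.map_apply_of_aemeasurable hm hE,
    Measure.restrict_apply' (Γ.isClosed_window t).measurableSet, arc, Measure.restrict_apply hE]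
  refine le_trans (measure_mono ?_) (hΓ.hausdorffMeasure_image_le
    (S := Γ.γ ⁻¹' E ∩ Γ.window t) (inter_subset_right.trans (Γ.window_subset_domain t))
    fun s hs s' hs' => Γ.abs_sub_le_of_mem_window hs.2 hs'.2)
  rintro x ⟨hx, hx'⟩
  obtain ⟨s, hs, rfl⟩ := Γ.carrier_subset_image_window t hx'
  exact ⟨s, ⟨hx, hs⟩, rfl⟩

theorem IsChordArc.lintegral_arc_le (t : ℝ) {f : Plane → ℝ≥0∞} (hf : Measurable f) :
    ∫⁻ y, f y ∂(arc Γ.carrier) ≤ ENNReal.ofReal L * ∫⁻ s in Γ.window t, f (Γ.γ s) := by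
  have hm : AEMeasurable Γ.γ (volume.restrict (Γ.window t)) :=
    (Γ.continuousOn_domain.mono (Γ.window_subset_domain t)).aemeasurable
      (Γ.isClosed_window t).measurableSet
  refine (lintegral_mono' (hΓ.arc_le_map t) le_rfl).trans ?_
  rw [lintegral_smul_measure, lintegral_map' hf.aemeasurable hm, smul_eq_mul]

omit hΓ in
theorem lintegral_inv_sq_of_le_abs (t : ℝ) {δ : ℝ} (hδ : 0 < δ) :
    ∫⁻ s in {s | δ ≤ |s - t|}, ENNReal.ofReal (|s - t| ^ (-2 : ℝ)) ≤ ENNReal.ofReal (2 / δ) := by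
  have hI : ∫⁻ s in Ioi δ, ENNReal.ofReal (|s| ^ (-2 : ℝ)) = ENNReal.ofReal (1 / δ) := by
    have h1 : ∫⁻ s in Ioi δ, ENNReal.ofReal (|s| ^ (-2 : ℝ))
        = ∫⁻ s in Ioi δ, ENNReal.ofReal (s ^ (-2 : ℝ)) := by
      refine setLIntegral_congr_fun measurableSet_Ioi fun s hs => ?_
      rw [abs_of_pos (hδ.trans hs)]
    rw [h1, ← ofReal_integral_eq_lintegral_ofReal
      (integrableOn_Ioi_rpow_of_lt (by norm_num) hδ) ?_, integral_Ioi_rpow_of_lt (by norm_num) hδ]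
    · congr 1
      norm_num [Real.rpow_neg_one]
    · filter_upwards [ae_restrict_mem measurableSet_Ioi] with s hs
      exact Real.rpow_nonneg (hδ.trans hs).le _
  have hf : Measurable fun s : ℝ => ENNReal.ofReal (|s| ^ (-2 : ℝ)) := by fun_prop
  have hI' : ∫⁻ s in Iio (-δ), ENNReal.ofReal (|s| ^ (-2 : ℝ)) = ENNReal.ofReal (1 / δ) := by
    rw [← hI, ← (Measure.measurePreserving_neg (volume : Measure ℝ)).setLIntegral_comp_preimage
      measurableSet_Ioi hf]
    simp
  have hS : ∫⁻ s in {s : ℝ | δ ≤ |s|}, ENNReal.ofReal (|s| ^ (-2 : ℝ)) ≤ ENNReal.ofReal (2 / δ) := by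
    have hsub : {s : ℝ | δ ≤ |s|} = Iic (-δ) ∪ Ici δ := by
      ext s
      simp only [mem_ofPred_eq, mem_union, mem_Iic, mem_Ici, le_abs']
    rw [hsub]
    refine (lintegral_union_le _ _ _).trans ?_
    rw [setLIntegral_congr (Iio_ae_eq_Iic (a := -δ)).symm,
      setLIntegral_congr (Ioi_ae_eq_Ici (a := δ)).symm, hI, hI',
      ← ENNReal.ofReal_add (by positivity) (by positivity)]
    refine le_of_eq ?_
    congr 1
    ring
  refine le_trans (le_of_eq ?_) hS
  have := (measurePreserving_sub_right (volume : Measure ℝ) t).setLIntegral_comp_preimage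
    (s := {s : ℝ | δ ≤ |s|}) (isClosed_le continuous_const continuous_abs).measurableSet hf
  exact this

/-- The far-field integral of `|x - y|⁻²` along the curve. -/
theorem IsChordArc.lintegral_far_le {t δ : ℝ} (ht : t ∈ Γ.domain) (hδ : 0 < δ) {A : Set Plane}
    (hA : MeasurableSet A) (hfar : ∀ s ∈ Γ.window t, Γ.γ s ∈ A → δ ≤ |s - t|) :
    ∫⁻ y in A, (‖Γ.γ t - y‖ₑ ^ 2)⁻¹ ∂(arc Γ.carrier) ≤ ENNReal.ofReal (2 * L / (c ^ 2 * δ)) := by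
  have hc := hΓ.c_pos
  have hL := hΓ.L_pos
  have hmeas : Measurable fun y : Plane => (‖Γ.γ t - y‖ₑ ^ 2)⁻¹ := by fun_prop
  rw [← lintegral_indicator hA]
  refine (hΓ.lintegral_arc_le t (hmeas.indicator hA)).trans ?_
  have hbound : ∫⁻ s in Γ.window t, A.indicator (fun y : Plane => (‖Γ.γ t - y‖ₑ ^ 2)⁻¹) (Γ.γ s)
      ≤ ∫⁻ s in {s | δ ≤ |s - t|}, ENNReal.ofReal (c ^ 2)⁻¹ *
        ENNReal.ofReal (|s - t| ^ (-2 : ℝ)) := by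
    have hms : MeasurableSet {s : ℝ | δ ≤ |s - t|} :=
      (isClosed_le continuous_const (continuous_id.sub continuous_const).abs).measurableSet
    rw [← lintegral_indicator (Γ.isClosed_window t).measurableSet, ← lintegral_indicator hms]
    refine lintegral_mono fun s => ?_
    by_cases hs : s ∈ Γ.window t
    swap
    · rw [indicator_of_notMem hs]
      exact zero_le
    rw [indicator_of_mem hs]
    by_cases hsA : Γ.γ s ∈ A
    swap
    · rw [indicator_of_notMem hsA]
      exact zero_le
    have hd := hfar s hs hsA
    have hpos : 0 < |s - t| := hδ.trans_le hd
    rw [indicator_of_mem hsA, indicator_of_mem (show s ∈ {s : ℝ | δ ≤ |s - t|} from hd)]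
    have hlow := hΓ.lower s hs.1 t ht hs.2
    rw [norm_sub_rev] at hlow
    have hn : 0 < ‖Γ.γ t - Γ.γ s‖ := lt_of_lt_of_le (by positivity) hlow
    rw [← ENNReal.ofReal_mul (by positivity), ← ofReal_norm,
      ← ENNReal.ofReal_pow hn.le, ← ENNReal.ofReal_inv_of_pos (by positivity)]
    refine ENNReal.ofReal_le_ofReal ?_
    rw [Real.rpow_neg hpos.le, Real.rpow_two, ← mul_inv, ← mul_pow]
    gcongr
  calc _ ≤ ENNReal.ofReal L * (ENNReal.ofReal (c ^ 2)⁻¹ * ENNReal.ofReal (2 / δ)) := by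
        gcongr
        refine hbound.trans ?_
        rw [lintegral_const_mul _ (by fun_prop)]
        gcongr
        exact lintegral_inv_sq_of_le_abs t hδ
    _ = _ := by
        rw [← ENNReal.ofReal_mul (by positivity), ← ENNReal.ofReal_mul hL.le]
        congr 1
        field_simp

end BoundaryPart

namespace BoundaryPart.Mesh

/-! ### Combinatorics of a mesh on a curve -/

variable {Γ : BoundaryPart} (𝒯 : Γ.Mesh)

theorem z_last : 𝒯.z (Fin.last 𝒯.n) = 𝒯.z 0 + (Γ.b - Γ.a) := by
  by_cases h : Γ.IsClosedCurve
  · exact 𝒯.endpoints_closed h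
  · obtain ⟨h1, h2⟩ := 𝒯.endpoints_open h
    rw [h1, h2]
    ring

theorem Icc_z_subset_domain : Icc (𝒯.z 0) (𝒯.z (Fin.last 𝒯.n)) ⊆ Γ.domain := by
  by_cases h : Γ.IsClosedCurve
  · rw [domain_of_closed h]
    exact subset_univ _
  · obtain ⟨h1, h2⟩ := 𝒯.endpoints_open h
    rw [h1, h2]
    exact Γ.Icc_subset_domain

theorem z_lt (j : Fin 𝒯.n) : 𝒯.z j.castSucc < 𝒯.z j.succ := 𝒯.strictMono Fin.castSucc_lt_succ

theorem z_zero_le (j : Fin (𝒯.n + 1)) : 𝒯.z 0 ≤ 𝒯.z j := 𝒯.strictMono.monotone (Fin.zero_le _)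

theorem z_le_last (j : Fin (𝒯.n + 1)) : 𝒯.z j ≤ 𝒯.z (Fin.last 𝒯.n) :=
  𝒯.strictMono.monotone (Fin.le_last _)

theorem Icc_subset_Icc_z (j : Fin 𝒯.n) :
    Icc (𝒯.z j.castSucc) (𝒯.z j.succ) ⊆ Icc (𝒯.z 0) (𝒯.z (Fin.last 𝒯.n)) :=
  Icc_subset_Icc (𝒯.z_zero_le _) (𝒯.z_le_last _)

theorem Icc_subset_domain (j : Fin 𝒯.n) : Icc (𝒯.z j.castSucc) (𝒯.z j.succ) ⊆ Γ.domain :=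
  (𝒯.Icc_subset_Icc_z j).trans 𝒯.Icc_z_subset_domain

theorem z_sub_le (j : Fin 𝒯.n) : 𝒯.z j.succ - 𝒯.z j.castSucc ≤ Γ.b - Γ.a := by
  linarith [𝒯.z_last, 𝒯.z_zero_le j.castSucc, 𝒯.z_le_last j.succ]

theorem element_subset_carrier (j : Fin 𝒯.n) : 𝒯.element j ⊆ Γ.carrier := by
  rintro _ ⟨s, hs, rfl⟩
  exact Γ.γ_mem_carrier (𝒯.Icc_subset_domain j hs)

theorem isCompact_element (j : Fin 𝒯.n) : IsCompact (𝒯.element j) :=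
  Γ.isCompact_image_Icc (𝒯.Icc_subset_domain j)

theorem measurableSet_element (j : Fin 𝒯.n) : MeasurableSet (𝒯.element j) :=
  (𝒯.isCompact_element j).measurableSet

theorem left_mem_element (j : Fin 𝒯.n) : Γ.γ (𝒯.z j.castSucc) ∈ 𝒯.element j :=
  ⟨_, left_mem_Icc.2 (𝒯.z_lt j).le, rfl⟩

theorem right_mem_element (j : Fin 𝒯.n) : Γ.γ (𝒯.z j.succ) ∈ 𝒯.element j :=
  ⟨_, right_mem_Icc.2 (𝒯.z_lt j).le, rfl⟩

theorem exists_mem_element {x : Plane} (hx : x ∈ Γ.carrier) : ∃ j, x ∈ 𝒯.element j := by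
  have hp : 0 < Γ.b - Γ.a := sub_pos.2 Γ.a_lt_b
  obtain ⟨u, hu, rfl⟩ := hx
  obtain ⟨s, hs, hsu⟩ : ∃ s ∈ Ioc (𝒯.z 0) (𝒯.z (Fin.last 𝒯.n)), Γ.γ s = Γ.γ u ∨ u = 𝒯.z 0 := by
    by_cases h : Γ.IsClosedCurve
    · obtain ⟨k, hk, -⟩ := existsUnique_add_zsmul_mem_Ioc hp u (𝒯.z 0)
      rw [← 𝒯.z_last] at hk
      refine ⟨_, hk, Or.inl ?_⟩
      simpa using Γ.γ_add_zsmul h u k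
    · obtain ⟨h1, h2⟩ := 𝒯.endpoints_open h
      rcases hu.1.eq_or_lt with h0 | h0
      · exact ⟨Γ.b, by rw [h1, h2]; exact ⟨Γ.a_lt_b, le_rfl⟩, Or.inr (by rw [h1, h0])⟩
      · exact ⟨u, by rw [h1, h2]; exact ⟨h0, hu.2⟩, Or.inl rfl⟩
  rcases hsu with hsu | hsu
  · obtain ⟨j, hj⟩ := exists_mem_Ioc_of_partition 𝒯.z hs.1 hs.2
    exact ⟨j, s, ⟨hj.1.le, hj.2⟩, hsu⟩
  · obtain ⟨j, hj⟩ := exists_mem_Ico_of_partition 𝒯.z le_rfl (hs.1.trans_le hs.2)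
    exact ⟨j, _, ⟨hj.1, hj.2.le⟩, by rw [hsu]⟩

/-- Two parameters of the mesh describe the same point only if they are equal, or if they are the
two ends of the parameter interval of a closed curve. -/
theorem eq_or_ends_of_γ_eq {s t : ℝ} (hs : s ∈ Icc (𝒯.z 0) (𝒯.z (Fin.last 𝒯.n)))
    (ht : t ∈ Icc (𝒯.z 0) (𝒯.z (Fin.last 𝒯.n))) (h : Γ.γ s = Γ.γ t) :
    s = t ∨ (s = 𝒯.z 0 ∧ t = 𝒯.z (Fin.last 𝒯.n)) ∨ (t = 𝒯.z 0 ∧ s = 𝒯.z (Fin.last 𝒯.n)) := by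
  have hp : 0 < Γ.b - Γ.a := sub_pos.2 Γ.a_lt_b
  have hl := 𝒯.z_last
  by_cases hcl : Γ.IsClosedCurve
  · obtain ⟨k, hk⟩ := Γ.exists_int_mem_Ico s
    obtain ⟨l, hl'⟩ := Γ.exists_int_mem_Ico t
    have := Γ.injOn_closed hcl hk hl' (by rw [Γ.γ_add_zsmul hcl, Γ.γ_add_zsmul hcl, h])
    have e : s - t = ((l - k : ℤ) : ℝ) * (Γ.b - Γ.a) := by push_cast; linarith
    have h1 : ((l - k : ℤ) : ℝ) ≤ 1 := by
      by_contra h'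
      nlinarith [hs.1, hs.2, ht.1, ht.2, not_le.1 h']
    have h2 : (-1 : ℝ) ≤ ((l - k : ℤ) : ℝ) := by
      by_contra h'
      nlinarith [hs.1, hs.2, ht.1, ht.2, not_le.1 h']
    have h1' : l - k ≤ 1 := by exact_mod_cast h1
    have h2' : -1 ≤ l - k := by exact_mod_cast h2
    have h3 : l - k = -1 ∨ l - k = 0 ∨ l - k = 1 := by omega
    rcases h3 with h3 | h3 | h3 <;> rw [h3] at e <;> push_cast at e
    · exact Or.inr (Or.inl ⟨by linarith [hs.1, hs.2, ht.1, ht.2],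
        by linarith [hs.1, hs.2, ht.1, ht.2]⟩)
    · exact Or.inl (by linarith)
    · exact Or.inr (Or.inr ⟨by linarith [hs.1, hs.2, ht.1, ht.2],
        by linarith [hs.1, hs.2, ht.1, ht.2]⟩)
  · obtain ⟨h1, h2⟩ := 𝒯.endpoints_open hcl
    rw [h1, h2] at hs ht
    exact Or.inl (Γ.injOn_open hcl hs ht h)

theorem eq_left_of_eq_z_zero {j : Fin 𝒯.n} {s : ℝ}
    (hs : s ∈ Icc (𝒯.z j.castSucc) (𝒯.z j.succ)) (h : s = 𝒯.z 0) : s = 𝒯.z j.castSucc :=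
  le_antisymm (h.le.trans (𝒯.z_zero_le _)) hs.1

theorem eq_right_of_eq_z_last {j : Fin 𝒯.n} {s : ℝ}
    (hs : s ∈ Icc (𝒯.z j.castSucc) (𝒯.z j.succ)) (h : s = 𝒯.z (Fin.last 𝒯.n)) :
    s = 𝒯.z j.succ :=
  le_antisymm hs.2 ((𝒯.z_le_last _).trans h.ge)

theorem z_succ_le_of_lt {i j : Fin 𝒯.n} (h : i < j) : 𝒯.z i.succ ≤ 𝒯.z j.castSucc :=
  𝒯.strictMono.monotone (by
    rw [Fin.le_def]
    simp only [Fin.val_succ, Fin.val_castSucc]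
    exact h)

/-- Elements that meet share an end point. -/
theorem endpoint_mem_of_inter_nonempty {i j : Fin 𝒯.n}
    (h : (𝒯.element i ∩ 𝒯.element j).Nonempty) :
    Γ.γ (𝒯.z j.castSucc) ∈ 𝒯.element i ∨ Γ.γ (𝒯.z j.succ) ∈ 𝒯.element i := by
  obtain ⟨x, ⟨s, hs, rfl⟩, t, ht, hst⟩ := h
  rcases 𝒯.eq_or_ends_of_γ_eq (𝒯.Icc_subset_Icc_z i hs) (𝒯.Icc_subset_Icc_z j ht) hst.symm with
    h | ⟨-, h⟩ | ⟨h, -⟩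
  · subst h
    rcases lt_trichotomy i j with hij | rfl | hij
    · left
      have := 𝒯.z_succ_le_of_lt hij
      rw [show 𝒯.z j.castSucc = s from le_antisymm ht.1 (hs.2.trans this)]
      exact ⟨s, hs, rfl⟩
    · exact Or.inl (𝒯.left_mem_element i)
    · right
      have := 𝒯.z_succ_le_of_lt hij
      rw [show 𝒯.z j.succ = s from le_antisymm (this.trans hs.1) ht.2]
      exact ⟨s, hs, rfl⟩
  · right
    rw [← 𝒯.eq_right_of_eq_z_last ht h, hst]
    exact ⟨s, hs, rfl⟩
  · left
    rw [← 𝒯.eq_left_of_eq_z_zero ht h, hst]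
    exact ⟨s, hs, rfl⟩

/-- The only nodes on an element are its end points. -/
theorem eq_endpoint_of_node_mem {j : Fin 𝒯.n} {k : Fin (𝒯.n + 1)}
    (h : Γ.γ (𝒯.z k) ∈ 𝒯.element j) :
    Γ.γ (𝒯.z k) = Γ.γ (𝒯.z j.castSucc) ∨ Γ.γ (𝒯.z k) = Γ.γ (𝒯.z j.succ) := by
  obtain ⟨s, hs, hst⟩ := h
  rw [← hst]
  rcases 𝒯.eq_or_ends_of_γ_eq (𝒯.Icc_subset_Icc_z j hs) ⟨𝒯.z_zero_le k, 𝒯.z_le_last k⟩ hst with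
    h | ⟨h, -⟩ | ⟨-, h⟩
  · rw [h] at hs
    have h1 := 𝒯.strictMono.le_iff_le.1 hs.1
    have h2 := 𝒯.strictMono.le_iff_le.1 hs.2
    rw [h]
    have h3 : k = j.castSucc ∨ k = j.succ := by
      simp only [Fin.le_def, Fin.val_castSucc, Fin.val_succ, Fin.ext_iff] at *
      omega
    rcases h3 with h3 | h3
    · exact Or.inl (by rw [h3])
    · exact Or.inr (by rw [h3])
  · exact Or.inl (by rw [𝒯.eq_left_of_eq_z_zero hs h])
  · exact Or.inr (by rw [𝒯.eq_right_of_eq_z_last hs h])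

open Classical in
theorem card_elements_of_mem_le (x : Plane) :
    (Finset.univ.filter fun j => x ∈ 𝒯.element j).card ≤ 2 := by
  by_contra hcard
  set F := Finset.univ.filter fun j => x ∈ 𝒯.element j with hF
  obtain ⟨f, hf⟩ : ∃ f : Fin 3 ↪o Fin 𝒯.n, ∀ i, f i ∈ F := by
    obtain ⟨G, hGF, hG⟩ := Finset.exists_subset_card_eq (not_le.1 hcard)
    exact ⟨G.orderEmbOfFin hG, fun i => hGF (Finset.orderEmbOfFin_mem G hG i)⟩
  have hmem : ∀ i, x ∈ 𝒯.element (f i) := fun i => (Finset.mem_filter.1 (hf i)).2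
  have h01 : f 0 < f 1 := f.strictMono (by decide)
  have h12 : f 1 < f 2 := f.strictMono (by decide)
  obtain ⟨s₀, hs₀, e₀⟩ := hmem 0
  obtain ⟨s₁, hs₁, e₁⟩ := hmem 1
  obtain ⟨s₂, hs₂, e₂⟩ := hmem 2
  have z01 := 𝒯.z_succ_le_of_lt h01
  have z12 := 𝒯.z_succ_le_of_lt h12
  have l0 := 𝒯.z_lt (f 0)
  have l1 := 𝒯.z_lt (f 1)
  have l2 := 𝒯.z_lt (f 2)
  have a0 := 𝒯.z_zero_le (f 0).castSucc
  have a2 := 𝒯.z_le_last (f 2).succ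
  have r01 := 𝒯.eq_or_ends_of_γ_eq (𝒯.Icc_subset_Icc_z _ hs₀) (𝒯.Icc_subset_Icc_z _ hs₁)
    (e₀.trans e₁.symm)
  have r12 := 𝒯.eq_or_ends_of_γ_eq (𝒯.Icc_subset_Icc_z _ hs₁) (𝒯.Icc_subset_Icc_z _ hs₂)
    (e₁.trans e₂.symm)
  obtain ⟨p0, q0⟩ := hs₀
  obtain ⟨p1, q1⟩ := hs₁
  obtain ⟨p2, q2⟩ := hs₂
  rcases r01 with r | ⟨r, r'⟩ | ⟨r, r'⟩ <;> rcases r12 with t | ⟨t, t'⟩ | ⟨t, t'⟩ <;> linarith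

open Classical in
theorem card_neighbours_le (j : Fin 𝒯.n) :
    (Finset.univ.filter fun i => (𝒯.element i ∩ 𝒯.element j).Nonempty).card ≤ 4 := by
  refine (Finset.card_le_card (t := (Finset.univ.filter fun i => Γ.γ (𝒯.z j.castSucc) ∈ 𝒯.element i)
    ∪ Finset.univ.filter fun i => Γ.γ (𝒯.z j.succ) ∈ 𝒯.element i) fun i hi => ?_).trans
    ((Finset.card_union_le _ _).trans
      (add_le_add (𝒯.card_elements_of_mem_le _) (𝒯.card_elements_of_mem_le _)))
  simpa using 𝒯.endpoint_mem_of_inter_nonempty (Finset.mem_filter.1 hi).2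

open Classical in
theorem card_nodes_of_element_le (j : Fin 𝒯.n) :
    (𝒯.nodes.filter fun z => z ∈ 𝒯.element j).card ≤ 2 := by
  refine (Finset.card_le_card (t := {Γ.γ (𝒯.z j.castSucc), Γ.γ (𝒯.z j.succ)}) fun z hz => ?_).trans
    Finset.card_le_two
  obtain ⟨hz, hzj⟩ := Finset.mem_filter.1 hz
  obtain ⟨k, -, rfl⟩ := Finset.mem_image.1 hz
  simpa using 𝒯.eq_endpoint_of_node_mem hzj

open Classical in
/-- A point lies in at most two elements, each of which has two nodes. -/
theorem card_nodePatches_of_mem_le (x : Plane) :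
    (𝒯.nodes.filter fun z => x ∈ 𝒯.nodePatch z).card ≤ 4 := by
  calc _ ≤ ((Finset.univ.filter fun j => x ∈ 𝒯.element j).biUnion fun j =>
        𝒯.nodes.filter fun z => z ∈ 𝒯.element j).card := by
        refine Finset.card_le_card fun z hz => ?_
        obtain ⟨hz, hx⟩ := Finset.mem_filter.1 hz
        simp only [nodePatch, mem_iUnion] at hx
        obtain ⟨j, hzj, hxj⟩ := hx
        simp only [Finset.mem_biUnion, Finset.mem_filter, Finset.mem_univ, true_and]
        exact ⟨j, hxj, hz, hzj⟩
    _ ≤ (Finset.univ.filter fun j => x ∈ 𝒯.element j).card * 2 :=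
        Finset.card_biUnion_le_card_mul _ _ _ fun j _ => 𝒯.card_nodes_of_element_le j
    _ ≤ 2 * 2 := Nat.mul_le_mul_right _ (𝒯.card_elements_of_mem_le x)

theorem nodePatch_subset_carrier (z : Plane) : 𝒯.nodePatch z ⊆ Γ.carrier :=
  iUnion₂_subset fun j _ => 𝒯.element_subset_carrier j

theorem measurableSet_nodePatch (z : Plane) : MeasurableSet (𝒯.nodePatch z) :=
  MeasurableSet.iUnion fun j => MeasurableSet.iUnion fun _ => 𝒯.measurableSet_element j

theorem element_subset_nodePatch {z : Plane} {j : Fin 𝒯.n} (h : z ∈ 𝒯.element j) :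
    𝒯.element j ⊆ 𝒯.nodePatch z := subset_iUnion₂_of_subset j h subset_rfl

theorem exists_node_of_inter_nonempty {i j : Fin 𝒯.n}
    (h : (𝒯.element i ∩ 𝒯.element j).Nonempty) :
    ∃ z ∈ 𝒯.nodes, z ∈ 𝒯.element i ∧ z ∈ 𝒯.element j := by
  classical
  rcases 𝒯.endpoint_mem_of_inter_nonempty h with h | h
  · exact ⟨_, Finset.mem_image_of_mem _ (Finset.mem_univ _), h, 𝒯.left_mem_element j⟩
  · exact ⟨_, Finset.mem_image_of_mem _ (Finset.mem_univ _), h, 𝒯.right_mem_element j⟩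

/-! ### Iterated patches as sets of elements -/

theorem sum_biUnion_le_sum_sum {ι κ : Type*} [DecidableEq ι] (s : Finset κ)
    (t : κ → Finset ι) {g : ι → ℝ} (hg : ∀ i, 0 ≤ g i) :
    ∑ i ∈ s.biUnion t, g i ≤ ∑ k ∈ s, ∑ i ∈ t k, g i := by
  classical
  induction s using Finset.induction_on with
  | empty => simp
  | insert k s hk ih =>
    rw [Finset.biUnion_insert, Finset.sum_insert hk]
    have h1 := Finset.sum_union_inter (s₁ := t k) (s₂ := s.biUnion t) (f := g)
    have h2 := Finset.sum_nonneg fun i (_ : i ∈ t k ∩ s.biUnion t) => hg i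
    linarith

open Classical in
/-- The elements that make up the patch `ω_h^m(T_j)`. -/
noncomputable def patchElements (j : Fin 𝒯.n) : ℕ → Finset (Fin 𝒯.n)
  | 0 => {j}
  | m + 1 => (patchElements j m).biUnion fun k =>
      Finset.univ.filter fun i => (𝒯.element i ∩ 𝒯.element k).Nonempty

theorem patch_subset (j : Fin 𝒯.n) (m : ℕ) :
    𝒯.patch j m ⊆ ⋃ i ∈ 𝒯.patchElements j m, 𝒯.element i := by
  induction m with
  | zero => simp [patch, patchElements]
  | succ m ih =>
    simp only [patch]
    refine iUnion₂_subset fun i hi => ?_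
    obtain ⟨x, hxi, hx⟩ := hi
    obtain ⟨k, hk, hxk⟩ := mem_iUnion₂.1 (ih hx)
    refine subset_iUnion₂_of_subset i ?_ subset_rfl
    simp only [patchElements, Finset.mem_biUnion, Finset.mem_filter, Finset.mem_univ, true_and]
    exact ⟨k, hk, x, hxi, hxk⟩

theorem patch_subset_carrier (j : Fin 𝒯.n) (m : ℕ) : 𝒯.patch j m ⊆ Γ.carrier :=
  (𝒯.patch_subset j m).trans (iUnion₂_subset fun i _ => 𝒯.element_subset_carrier i)

/-- Every element belongs to a number of patches of order `m` that is bounded independently of the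
mesh, because every element meets at most four elements. -/
theorem sum_patchElements_le (m : ℕ) (g : Fin 𝒯.n → ℝ) (hg : ∀ i, 0 ≤ g i) :
    ∑ j, ∑ i ∈ 𝒯.patchElements j m, g i ≤ 4 ^ m * ∑ i, g i := by
  classical
  induction m generalizing g with
  | zero => simp [patchElements]
  | succ m ih =>
    have h1 : ∀ j, ∑ i ∈ 𝒯.patchElements j (m + 1), g i ≤ ∑ k ∈ 𝒯.patchElements j m,
        ∑ i ∈ Finset.univ.filter fun i => (𝒯.element i ∩ 𝒯.element k).Nonempty, g i :=
      fun j => sum_biUnion_le_sum_sum _ _ hg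
    refine (Finset.sum_le_sum fun j _ => h1 j).trans ((ih _ fun k =>
      Finset.sum_nonneg fun i _ => hg i).trans ?_)
    rw [pow_succ, mul_assoc]
    gcongr
    simp only [Finset.sum_filter]
    rw [Finset.sum_comm, Finset.mul_sum]
    refine Finset.sum_le_sum fun i _ => ?_
    rw [← Finset.sum_filter, Finset.sum_const, nsmul_eq_mul]
    gcongr
    · exact hg i
    · have := 𝒯.card_neighbours_le i
      simp only [inter_comm (𝒯.element i)]
      exact_mod_cast this

/-! ### Element sizes and distances -/

theorem size_le_kappa_mul {i j : Fin 𝒯.n} (h : (𝒯.element i ∩ 𝒯.element j).Nonempty)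
    (hj : 0 < 𝒯.size j) : 𝒯.size i ≤ 𝒯.kappa * 𝒯.size j := by
  rw [← div_le_iff₀ hj]
  refine le_csSup (Set.Finite.bddAbove ?_) ⟨i, j, h, rfl⟩
  refine (Set.finite_range fun p : Fin 𝒯.n × Fin 𝒯.n => 𝒯.size p.1 / 𝒯.size p.2).subset ?_
  rintro _ ⟨i, j, -, rfl⟩
  exact ⟨(i, j), rfl⟩

theorem size_eq_toReal (j : Fin 𝒯.n) :
    𝒯.size j = ((arc Γ.carrier) (𝒯.element j)).toReal := by
  rw [size, arclength, arc, arc, Measure.restrict_apply_univ,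
    Measure.restrict_apply (𝒯.measurableSet_element j),
    inter_eq_self_of_subset_left (𝒯.element_subset_carrier j)]

section ChordArc

variable {𝒯} {c L : ℝ} (hΓ : Γ.IsChordArc c L)

include hΓ

theorem size_le (j : Fin 𝒯.n) : 𝒯.size j ≤ L * (𝒯.z j.succ - 𝒯.z j.castSucc) :=
  hΓ.arclength_image_Icc_le (𝒯.z_lt j).le (𝒯.Icc_subset_domain j) (𝒯.z_sub_le j)

theorem le_size (j : Fin 𝒯.n) : c / 2 * (𝒯.z j.succ - 𝒯.z j.castSucc) ≤ 𝒯.size j :=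
  hΓ.le_arclength_image_Icc (𝒯.z_lt j).le (𝒯.Icc_subset_domain j) (𝒯.z_sub_le j)

theorem size_pos (j : Fin 𝒯.n) : 0 < 𝒯.size j :=
  (mul_pos (half_pos hΓ.c_pos) (sub_pos.2 (𝒯.z_lt j))).trans_le (𝒯.le_size hΓ j)

/-- The diameter of an element is bounded by a multiple of its arclength. -/
theorem dist_le_of_mem_element {j : Fin 𝒯.n} {x y : Plane} (hx : x ∈ 𝒯.element j)
    (hy : y ∈ 𝒯.element j) : ‖x - y‖ ≤ 2 * L / c * 𝒯.size j := by
  obtain ⟨s, hs, rfl⟩ := hx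
  obtain ⟨t, ht, rfl⟩ := hy
  have hc := hΓ.c_pos
  have hL := hΓ.L_pos
  have hst : |s - t| ≤ 𝒯.z j.succ - 𝒯.z j.castSucc :=
    abs_le.2 ⟨by linarith [hs.1, ht.2], by linarith [hs.2, ht.1]⟩
  refine (hΓ.upper s (𝒯.Icc_subset_domain j hs) t (𝒯.Icc_subset_domain j ht)
    (hst.trans (𝒯.z_sub_le j))).trans ?_
  have := 𝒯.le_size hΓ j
  calc L * |s - t| ≤ L * (𝒯.z j.succ - 𝒯.z j.castSucc) := by gcongr
    _ = 2 * L / c * (c / 2 * (𝒯.z j.succ - 𝒯.z j.castSucc)) := by field_simp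
    _ ≤ _ := by gcongr

end ChordArc

theorem exists_element_right {j : Fin 𝒯.n} (h : Γ.IsClosedCurve ∨ j.succ ≠ Fin.last 𝒯.n) :
    ∃ i, ∀ s, 𝒯.z j.succ ≤ s → s ≤ 𝒯.z j.succ + (𝒯.z i.succ - 𝒯.z i.castSucc) →
      Γ.γ s ∈ 𝒯.element i := by
  by_cases hj : j.succ = Fin.last 𝒯.n
  · have hcl := h.resolve_right (not_not.2 hj)
    have h0 : (⟨0, j.pos⟩ : Fin 𝒯.n).castSucc = 0 := rfl
    refine ⟨⟨0, j.pos⟩, fun s h1 h2 => ?_⟩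
    rw [h0] at h2
    rw [hj, 𝒯.z_last] at h1 h2
    refine ⟨s - (Γ.b - Γ.a), ⟨?_, by linarith⟩, (Γ.periodic hcl).sub_eq s⟩
    rw [h0]
    linarith
  · obtain ⟨i, hi⟩ := Fin.exists_castSucc_eq.2 hj
    refine ⟨i, fun s h1 h2 => ⟨s, ⟨?_, ?_⟩, rfl⟩⟩ <;> rw [← hi] at h1 h2 <;> linarith

theorem exists_element_left {j : Fin 𝒯.n} (h : Γ.IsClosedCurve ∨ j.castSucc ≠ 0) :
    ∃ i, ∀ s, s ≤ 𝒯.z j.castSucc → 𝒯.z j.castSucc - (𝒯.z i.succ - 𝒯.z i.castSucc) ≤ s →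
      Γ.γ s ∈ 𝒯.element i := by
  by_cases hj : j.castSucc = 0
  · have hcl := h.resolve_right (not_not.2 hj)
    have hn := j.pos
    obtain ⟨i, hi⟩ : ∃ i : Fin 𝒯.n, i.succ = Fin.last 𝒯.n :=
      Fin.exists_succ_eq.2 (by simp [Fin.ext_iff, hn.ne'])
    refine ⟨i, fun s h1 h2 => ?_⟩
    rw [hi, 𝒯.z_last] at h2
    rw [hj] at h1 h2
    refine ⟨s + (Γ.b - Γ.a), ⟨by linarith, ?_⟩, Γ.periodic hcl s⟩
    rw [hi, 𝒯.z_last]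
    linarith
  · obtain ⟨i, hi⟩ := Fin.exists_succ_eq.2 hj
    refine ⟨i, fun s h1 h2 => ⟨s, ⟨?_, ?_⟩, rfl⟩⟩ <;> rw [← hi] at h1 h2 <;> linarith

/-- To leave the patch of an element along the curve one has to pass one of its neighbours. -/
theorem exists_neighbour_length_le {j : Fin 𝒯.n} {s t : ℝ}
    (ht : t ∈ Icc (𝒯.z j.castSucc) (𝒯.z j.succ)) (hs : s ∈ Γ.domain)
    (hfar : Γ.γ s ∉ 𝒯.patch j 1) :
    ∃ i, (𝒯.element j ∩ 𝒯.element i).Nonempty ∧ 𝒯.z i.succ - 𝒯.z i.castSucc ≤ |s - t| := by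
  have hpatch : ∀ i, (𝒯.element i ∩ 𝒯.element j).Nonempty → Γ.γ s ∉ 𝒯.element i :=
    fun i hi hmem => hfar (mem_iUnion₂.2 ⟨i, hi, hmem⟩)
  have hself := hpatch j ⟨_, 𝒯.left_mem_element j, 𝒯.left_mem_element j⟩
  have hsj : s ∉ Icc (𝒯.z j.castSucc) (𝒯.z j.succ) := fun h => hself ⟨s, h, rfl⟩
  rcases lt_or_ge s (𝒯.z j.castSucc) with h1 | h1
  · have h : Γ.IsClosedCurve ∨ j.castSucc ≠ 0 := by
      by_cases hcl : Γ.IsClosedCurve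
      · exact Or.inl hcl
      · refine Or.inr fun h0 => ?_
        rw [domain_of_open hcl] at hs
        rw [h0, (𝒯.endpoints_open hcl).1] at h1
        linarith [hs.1]
    obtain ⟨i, hi⟩ := 𝒯.exists_element_left h
    have hmeet : Γ.γ (𝒯.z j.castSucc) ∈ 𝒯.element i :=
      hi _ le_rfl (by linarith [𝒯.z_lt i])
    refine ⟨i, ⟨_, 𝒯.left_mem_element j, hmeet⟩, ?_⟩
    have h2 : s < 𝒯.z j.castSucc - (𝒯.z i.succ - 𝒯.z i.castSucc) := by
      by_contra h'
      exact hpatch i ⟨_, hmeet, 𝒯.left_mem_element j⟩ (hi s h1.le (not_lt.1 h'))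
    rw [abs_sub_comm]
    exact le_trans (by linarith [ht.1]) (le_abs_self _)
  · have h1' : 𝒯.z j.succ < s := by
      by_contra h'
      exact hsj ⟨h1, not_lt.1 h'⟩
    have h : Γ.IsClosedCurve ∨ j.succ ≠ Fin.last 𝒯.n := by
      by_cases hcl : Γ.IsClosedCurve
      · exact Or.inl hcl
      · refine Or.inr fun h0 => ?_
        rw [domain_of_open hcl] at hs
        rw [h0, (𝒯.endpoints_open hcl).2] at h1'
        linarith [hs.2]
    obtain ⟨i, hi⟩ := 𝒯.exists_element_right h
    have hmeet : Γ.γ (𝒯.z j.succ) ∈ 𝒯.element i :=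
      hi _ le_rfl (by linarith [𝒯.z_lt i])
    refine ⟨i, ⟨_, 𝒯.right_mem_element j, hmeet⟩, ?_⟩
    have h2 : 𝒯.z j.succ + (𝒯.z i.succ - 𝒯.z i.castSucc) < s := by
      by_contra h'
      exact hpatch i ⟨_, hmeet, 𝒯.right_mem_element j⟩ (hi s h1'.le (not_lt.1 h'))
    exact le_trans (by linarith [ht.2]) (le_abs_self _)

/-- On a shape regular mesh, integrating `|x - y|⁻²` over the complement of the patch of an element
costs one power of the element size. -/
theorem lintegral_compl_patch_le {c L : ℝ} (hΓ : Γ.IsChordArc c L) {κ : ℝ} (hκ0 : 0 < κ)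
    (hκ : 𝒯.kappa ≤ κ) {j : Fin 𝒯.n} {x : Plane} (hx : x ∈ 𝒯.element j) :
    ∫⁻ y in (𝒯.patch j 1)ᶜ, (‖x - y‖ₑ ^ 2)⁻¹ ∂(arc Γ.carrier) ≤
      ENNReal.ofReal (2 * L ^ 2 * κ / c ^ 2 / 𝒯.size j) := by
  obtain ⟨t, ht, rfl⟩ := hx
  have hc := hΓ.c_pos
  have hL := hΓ.L_pos
  have hj := 𝒯.size_pos hΓ j
  have hm : MeasurableSet (𝒯.patch j 1) :=
    MeasurableSet.iUnion fun i => MeasurableSet.iUnion fun _ => 𝒯.measurableSet_element i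
  refine (hΓ.lintegral_far_le (𝒯.Icc_subset_domain j ht) (δ := 𝒯.size j / (L * κ)) (by positivity)
    hm.compl fun s hs hsA => ?_).trans (le_of_eq ?_)
  · obtain ⟨i, hi, hle⟩ := 𝒯.exists_neighbour_length_le ht hs.1 hsA
    have h0 := 𝒯.size_pos hΓ i
    have h1 := 𝒯.size_le_kappa_mul hi h0
    have h2 := 𝒯.size_le hΓ i
    rw [div_le_iff₀ (by positivity)]
    calc 𝒯.size j ≤ κ * (L * (𝒯.z i.succ - 𝒯.z i.castSucc)) :=
          h1.trans (mul_le_mul hκ h2 h0.le hκ0.le)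
      _ ≤ κ * (L * |s - t|) := by gcongr
      _ = |s - t| * (L * κ) := by ring
  · congr 1
    field_simp

end BoundaryPart.Mesh

/-! ### Integral inequalities on a measure space in the plane -/

section Integrals

variable {μ : Measure Plane} {r : Plane → ℝ}

/-- The integrand of the Sobolev-Slobodeckij seminorm. -/
noncomputable def slobodeckijKernel (r : Plane → ℝ) (p : Plane × Plane) : ℝ≥0∞ :=
  ‖r p.1 - r p.2‖ₑ ^ 2 / ‖p.1 - p.2‖ₑ ^ 2

theorem measurable_slobodeckijKernel (hr : Measurable r) : Measurable (slobodeckijKernel r) := by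
  have h1 : Measurable fun p : Plane × Plane => r p.1 := hr.comp measurable_fst
  have h2 : Measurable fun p : Plane × Plane => r p.2 := hr.comp measurable_snd
  have h3 : Measurable fun p : Plane × Plane => p.1 - p.2 := by fun_prop
  exact ((h1.sub h2).enorm.pow_const 2).div (h3.enorm.pow_const 2)

theorem enorm_sub_sq_le (a b c : ℝ) : ‖a - c‖ₑ ^ 2 ≤ 2 * ‖a - b‖ₑ ^ 2 + 2 * ‖b - c‖ₑ ^ 2 := by
  have h : ∀ x : ℝ, ‖x‖ₑ ^ 2 = ENNReal.ofReal (x ^ 2) := fun x => by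
    rw [Real.enorm_eq_ofReal_abs, ← ENNReal.ofReal_pow (abs_nonneg _), sq_abs]
  have h2 : (2 : ℝ≥0∞) = ENNReal.ofReal 2 := by simp
  rw [h, h, h, h2, ← ENNReal.ofReal_mul two_pos.le, ← ENNReal.ofReal_mul two_pos.le,
    ← ENNReal.ofReal_add (by positivity) (by positivity)]
  refine ENNReal.ofReal_le_ofReal ?_
  nlinarith [sq_nonneg (a - 2 * b + c)]

theorem enorm_sub_sq_le_slobodeckijKernel (r : Plane → ℝ) {x y : Plane} {d : ℝ}
    (h : ‖x - y‖ ≤ d) :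
    ‖r x - r y‖ₑ ^ 2 ≤ ENNReal.ofReal (d ^ 2) * slobodeckijKernel r (x, y) := by
  rcases eq_or_ne x y with rfl | hxy
  · simp
  · have h0 : ‖x - y‖ₑ ^ 2 ≠ 0 := by simpa [sub_eq_zero] using hxy
    have h1 : ‖x - y‖ₑ ^ 2 ≠ ∞ := by simp
    have h2 : ‖x - y‖ₑ ^ 2 ≤ ENNReal.ofReal (d ^ 2) := by
      rw [← ofReal_norm, ← ENNReal.ofReal_pow (norm_nonneg _)]
      exact ENNReal.ofReal_le_ofReal (by gcongr)
    calc ‖r x - r y‖ₑ ^ 2 = ‖x - y‖ₑ ^ 2 * slobodeckijKernel r (x, y) := by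
          rw [slobodeckijKernel, ENNReal.mul_div_cancel h0 h1]
      _ ≤ _ := by gcongr

theorem slobodeckijKernel_le (r : Plane → ℝ) (x y : Plane) :
    slobodeckijKernel r (x, y) ≤
      2 * (‖r x‖ₑ ^ 2 * (‖x - y‖ₑ ^ 2)⁻¹) + 2 * (‖r y‖ₑ ^ 2 * (‖x - y‖ₑ ^ 2)⁻¹) := by
  have h := enorm_sub_sq_le (r x) 0 (r y)
  rw [sub_zero, zero_sub, enorm_neg] at h
  rw [slobodeckijKernel, div_eq_mul_inv, ← mul_assoc, ← mul_assoc, ← add_mul]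
  gcongr

/-- The deviation from a constant spreads from a set `A` to a set `B` at the cost of the
interaction of `A` with `B`. -/
theorem measure_mul_lintegral_sub_sq_le (hr : Measurable r) {A B : Set Plane}
    (hA : MeasurableSet A) (hB : MeasurableSet B) {d : ℝ}
    (hd : ∀ x ∈ A, ∀ y ∈ B, ‖x - y‖ ≤ d) (c : ℝ) [SFinite μ] :
    μ A * ∫⁻ y in B, ‖r y - c‖ₑ ^ 2 ∂μ ≤
      2 * ENNReal.ofReal (d ^ 2) * (∫⁻ x in A, ∫⁻ y in B, slobodeckijKernel r (x, y) ∂μ ∂μ) +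
        2 * μ B * ∫⁻ x in A, ‖r x - c‖ₑ ^ 2 ∂μ := by
  have hK := measurable_slobodeckijKernel hr
  have hf : Measurable fun x => ‖r x - c‖ₑ ^ 2 := (hr.sub_const c).enorm.pow_const 2
  have hinner : ∀ x, Measurable fun y => slobodeckijKernel r (x, y) :=
    fun x => hK.comp measurable_prodMk_left
  have hpt : ∀ x ∈ A, ∫⁻ y in B, ‖r y - c‖ₑ ^ 2 ∂μ ≤
      2 * ENNReal.ofReal (d ^ 2) * (∫⁻ y in B, slobodeckijKernel r (x, y) ∂μ) +
        2 * μ B * ‖r x - c‖ₑ ^ 2 := by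
    intro x hx
    calc ∫⁻ y in B, ‖r y - c‖ₑ ^ 2 ∂μ
        ≤ ∫⁻ y in B, (2 * ENNReal.ofReal (d ^ 2) * slobodeckijKernel r (x, y) +
            2 * ‖r x - c‖ₑ ^ 2) ∂μ := by
          refine setLIntegral_mono' hB fun y hy => ?_
          refine (enorm_sub_sq_le (r y) (r x) c).trans ?_
          rw [mul_assoc, enorm_sub_rev (r y)]
          gcongr
          exact enorm_sub_sq_le_slobodeckijKernel r (hd x hx y hy)
      _ = _ := by
          rw [lintegral_add_left ((hinner x).const_mul _), lintegral_const_mul _ (hinner x),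
            setLIntegral_const, mul_right_comm 2 (μ B)]
  calc μ A * ∫⁻ y in B, ‖r y - c‖ₑ ^ 2 ∂μ
      = ∫⁻ _ in A, ∫⁻ y in B, ‖r y - c‖ₑ ^ 2 ∂μ ∂μ := by rw [setLIntegral_const, mul_comm]
    _ ≤ ∫⁻ x in A, (2 * ENNReal.ofReal (d ^ 2) * (∫⁻ y in B, slobodeckijKernel r (x, y) ∂μ) +
        2 * μ B * ‖r x - c‖ₑ ^ 2) ∂μ := setLIntegral_mono' hA hpt
    _ = _ := by
        have hm : Measurable fun x => ∫⁻ y in B, slobodeckijKernel r (x, y) ∂μ :=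
          hK.lintegral_prod_right'
        rw [lintegral_add_left (hm.const_mul _), lintegral_const_mul _ hm,
          lintegral_const_mul _ hf]

/-- A Poincaré inequality: the values of `r` on `A` serve as constants, and one of them is at least
as good as the average. -/
theorem exists_measure_mul_lintegral_sub_sq_le (hr : Measurable r) {A : Set Plane}
    (hA : MeasurableSet A) (hA0 : μ A ≠ 0) (hA1 : μ A ≠ ∞) {d : ℝ}
    (hd : ∀ x ∈ A, ∀ y ∈ A, ‖x - y‖ ≤ d) [SFinite μ] :
    ∃ c : ℝ, μ A * ∫⁻ y in A, ‖r y - c‖ₑ ^ 2 ∂μ ≤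
      ENNReal.ofReal (d ^ 2) * ∫⁻ x in A, ∫⁻ y in A, slobodeckijKernel r (x, y) ∂μ ∂μ := by
  have hK := measurable_slobodeckijKernel hr
  have hm : Measurable fun x => ∫⁻ y in A, slobodeckijKernel r (x, y) ∂μ :=
    hK.lintegral_prod_right'
  obtain ⟨x, hx, h⟩ := exists_le_setLAverage hA0 hA1 hm.aemeasurable
  refine ⟨r x, ?_⟩
  rw [setLAverage_eq, ENNReal.le_div_iff_mul_le (Or.inl hA0) (Or.inl hA1)] at h
  calc μ A * ∫⁻ y in A, ‖r y - r x‖ₑ ^ 2 ∂μ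
      ≤ μ A * (ENNReal.ofReal (d ^ 2) * ∫⁻ y in A, slobodeckijKernel r (x, y) ∂μ) := by
        gcongr
        have hKx : Measurable fun y => slobodeckijKernel r (x, y) := hK.comp measurable_prodMk_left
        rw [← lintegral_const_mul _ hKx]
        refine setLIntegral_mono' hA fun y hy => ?_
        rw [enorm_sub_rev]
        exact enorm_sub_sq_le_slobodeckijKernel r (hd x hx y hy)
    _ = ENNReal.ofReal (d ^ 2) * ((∫⁻ y in A, slobodeckijKernel r (x, y) ∂μ) * μ A) := by ring
    _ ≤ _ := by gcongr

/-- If `r` is orthogonal to a function `ψ` that is close to `1` in the mean, then subtracting a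
constant from `r` cannot reduce its norm by more than a fixed factor. -/
theorem mul_integral_sq_le_of_orthogonal {α : Type*} [MeasurableSpace α] {ν : Measure α}
    [IsFiniteMeasure ν] {r ψ : α → ℝ} (hr : MemLp r 2 ν) (hψ : MemLp ψ 2 ν)
    (horth : ∫ x, r x * ψ x ∂ν = 0) {q : ℝ} (hq : q ≤ 1)
    (hclose : ∫ x, (1 - ψ x) ^ 2 ∂ν ≤ (1 - q) * ν.real univ) (c : ℝ) :
    q * ∫ x, r x ^ 2 ∂ν ≤ ∫ x, (r x - c) ^ 2 ∂ν := by
  have hr1 : Integrable r ν := hr.integrable (by norm_num)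
  have hr2 : Integrable (fun x => r x ^ 2) ν := hr.integrable_sq
  have hrψ : Integrable (fun x => r x * ψ x) ν := hr.integrable_mul hψ
  have h1ψ : MemLp (fun x => 1 - ψ x) 2 ν := (memLp_const 1).sub hψ
  have h1ψ2 : Integrable (fun x => (1 - ψ x) ^ 2) ν := h1ψ.integrable_sq
  have hM : ∫ x, r x * (1 - ψ x) ∂ν = ∫ x, r x ∂ν := by
    simp only [mul_sub, mul_one]
    rw [integral_sub hr1 hrψ, horth, sub_zero]
  have hexp : ∫ x, (r x - c) ^ 2 ∂ν
      = ∫ x, r x ^ 2 ∂ν - 2 * c * ∫ x, r x ∂ν + c ^ 2 * ν.real univ := by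
    have e : (fun x => (r x - c) ^ 2) = fun x => r x ^ 2 - 2 * c * r x + c ^ 2 := by
      ext x
      ring
    have h1 : Integrable (fun x => r x ^ 2 - 2 * c * r x) ν := hr2.sub (hr1.const_mul _)
    rw [e, integral_add h1 (integrable_const _),
      integral_sub hr2 (hr1.const_mul _), integral_const_mul, integral_const, smul_eq_mul]
    ring
  have hR : 0 ≤ ∫ x, r x ^ 2 ∂ν := integral_nonneg fun x => sq_nonneg _
  -- Young's inequality with a weight slightly above `1 - q`, which may vanish
  have hyoung : ∀ ε : ℝ, 0 < ε → 2 * c * ∫ x, r x ∂ν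
      ≤ (1 - q + ε) * ∫ x, r x ^ 2 ∂ν + c ^ 2 * ν.real univ := by
    intro ε hε
    have hw : 0 < 1 - q + ε := by linarith
    have h1 : ∫ x, 2 * c * (r x * (1 - ψ x)) ∂ν
        ≤ ∫ x, ((1 - q + ε) * r x ^ 2 + c ^ 2 / (1 - q + ε) * (1 - ψ x) ^ 2) ∂ν := by
      refine integral_mono ((hr.integrable_mul h1ψ).const_mul _)
        ((hr2.const_mul _).add (h1ψ2.const_mul _)) fun x => ?_
      have h2 : 0 ≤ ((1 - q + ε) * r x - c * (1 - ψ x)) ^ 2 / (1 - q + ε) := by positivity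
      have h3 : ((1 - q + ε) * r x - c * (1 - ψ x)) ^ 2 / (1 - q + ε)
          = (1 - q + ε) * r x ^ 2 + c ^ 2 / (1 - q + ε) * (1 - ψ x) ^ 2
            - 2 * c * (r x * (1 - ψ x)) := by
        field_simp
        ring
      simp only
      linarith
    rw [integral_const_mul, hM, integral_add (hr2.const_mul _) (h1ψ2.const_mul _),
      integral_const_mul, integral_const_mul] at h1
    refine h1.trans (add_le_add_right ?_ _)
    calc c ^ 2 / (1 - q + ε) * ∫ x, (1 - ψ x) ^ 2 ∂ν
        ≤ c ^ 2 / (1 - q + ε) * ((1 - q + ε) * ν.real univ) := by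
          gcongr
          refine hclose.trans ?_
          gcongr
          linarith
      _ = c ^ 2 * ν.real univ := by field_simp
  rw [hexp]
  by_contra hcon
  rw [not_le] at hcon
  set R := ∫ x, r x ^ 2 ∂ν
  set g := q * R - (R - 2 * c * ∫ x, r x ∂ν + c ^ 2 * ν.real univ) with hg
  have hgpos : 0 < g := sub_pos.2 hcon
  have h := hyoung (g / (2 * (R + 1))) (by positivity)
  have h' : g / (2 * (R + 1)) * R ≤ g / 2 := by
    rw [div_mul_eq_mul_div, div_le_div_iff₀ (by positivity) two_pos]
    nlinarith
  nlinarith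

/-- Away from a symmetric neighbourhood `N` of the diagonal the seminorm is controlled by a weighted
`L²` norm. -/
theorem lintegral_slobodeckijKernel_compl_le [SFinite μ] (hr : Measurable r)
    {N : Set (Plane × Plane)} (hN : MeasurableSet N) (hsymm : Prod.swap ⁻¹' N = N) :
    ∫⁻ p in Nᶜ, slobodeckijKernel r p ∂(μ.prod μ) ≤
      4 * ∫⁻ p in Nᶜ, ‖r p.1‖ₑ ^ 2 * (‖p.1 - p.2‖ₑ ^ 2)⁻¹ ∂(μ.prod μ) := by
  have hf : Measurable fun p : Plane × Plane => ‖r p.1‖ₑ ^ 2 * (‖p.1 - p.2‖ₑ ^ 2)⁻¹ := by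
    have h1 : Measurable fun p : Plane × Plane => r p.1 := hr.comp measurable_fst
    have h3 : Measurable fun p : Plane × Plane => p.1 - p.2 := by fun_prop
    exact (h1.enorm.pow_const 2).mul (h3.enorm.pow_const 2).inv
  have hswap : ∫⁻ p in Nᶜ, ‖r p.2‖ₑ ^ 2 * (‖p.1 - p.2‖ₑ ^ 2)⁻¹ ∂(μ.prod μ)
      = ∫⁻ p in Nᶜ, ‖r p.1‖ₑ ^ 2 * (‖p.1 - p.2‖ₑ ^ 2)⁻¹ ∂(μ.prod μ) := by
    have h := (Measure.measurePreserving_swap (μ := μ) (ν := μ)).setLIntegral_comp_preimage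
      hN.compl hf
    rw [preimage_compl, hsymm] at h
    rw [← h]
    refine lintegral_congr fun p => ?_
    rw [Prod.fst_swap, Prod.snd_swap, enorm_sub_rev p.2]
  calc ∫⁻ p in Nᶜ, slobodeckijKernel r p ∂(μ.prod μ)
      ≤ ∫⁻ p in Nᶜ, (2 * (‖r p.1‖ₑ ^ 2 * (‖p.1 - p.2‖ₑ ^ 2)⁻¹) +
          2 * (‖r p.2‖ₑ ^ 2 * (‖p.1 - p.2‖ₑ ^ 2)⁻¹)) ∂(μ.prod μ) :=
        lintegral_mono fun p => slobodeckijKernel_le r p.1 p.2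
    _ = _ := by
        rw [lintegral_add_left (hf.const_mul _), lintegral_const_mul _ hf,
          lintegral_const_mul' _ _ (by simp), hswap, ← add_mul]
        norm_num

end Integrals

theorem setLIntegral_le_sum_of_subset_biUnion {α ι : Type*} [MeasurableSpace α] {μ : Measure α}
    (s : Finset ι) {A : ι → Set α} {S : Set α} (hS : S ⊆ ⋃ i ∈ s, A i) (f : α → ℝ≥0∞) :
    ∫⁻ x in S, f x ∂μ ≤ ∑ i ∈ s, ∫⁻ x in A i, f x ∂μ := by
  classical
  refine (lintegral_mono_set hS).trans ?_
  clear hS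
  induction s using Finset.induction_on with
  | empty => simp
  | insert k s hk ih =>
    rw [Finset.set_biUnion_insert, Finset.sum_insert hk]
    exact (lintegral_union_le _ _ _).trans (by gcongr)

/-! ### The quantities of the localization argument -/

namespace BoundaryPart

variable {Γ : BoundaryPart} (u : HHalf Γ.carrier)

/-- The contribution `∫_A ∫_B |u(x) - u(y)|² / |x - y|² dy dx` of two subsets `A` and `B` of `Γ` to
the Sobolev-Slobodeckij seminorm. -/
noncomputable def interaction (A B : Set Plane) : ℝ :=
  (∫⁻ x in A, ∫⁻ y in B, slobodeckijKernel u.toL2 (x, y) ∂(arc Γ.carrier) ∂(arc Γ.carrier)).toReal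

/-- The squared distance `‖u - c‖²_{L²(A)}` to a constant. -/
noncomputable def deviationSq (c : ℝ) (A : Set Plane) : ℝ :=
  ∫ x in A, (u.toL2 x - c) ^ 2 ∂(arc Γ.carrier)

theorem interaction_nonneg (A B : Set Plane) : 0 ≤ interaction u A B := ENNReal.toReal_nonneg

theorem deviationSq_nonneg (c : ℝ) (A : Set Plane) : 0 ≤ deviationSq u c A :=
  integral_nonneg fun _ => sq_nonneg _

theorem measurable_toL2 : Measurable (u.toL2 : Plane → ℝ) :=
  (Lp.stronglyMeasurable u.toL2).measurable

theorem interaction_lintegral_ne_top (A B : Set Plane) :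
    ∫⁻ x in A, ∫⁻ y in B, slobodeckijKernel u.toL2 (x, y) ∂(arc Γ.carrier) ∂(arc Γ.carrier)
      ≠ ∞ := by
  refine ne_top_of_le_ne_top u.slobodeckijSq_lt_top.ne ((setLIntegral_le_lintegral _ _).trans ?_)
  exact lintegral_mono fun x => setLIntegral_le_lintegral _ _

theorem ofReal_interaction (A B : Set Plane) : ENNReal.ofReal (interaction u A B) =
    ∫⁻ x in A, ∫⁻ y in B, slobodeckijKernel u.toL2 (x, y) ∂(arc Γ.carrier) ∂(arc Γ.carrier) :=
  ENNReal.ofReal_toReal (interaction_lintegral_ne_top u A B)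

theorem interaction_mono {A A' B B' : Set Plane} (hA : A ⊆ A') (hB : B ⊆ B') :
    interaction u A B ≤ interaction u A' B' :=
  ENNReal.toReal_mono (interaction_lintegral_ne_top u A' B')
    (lintegral_mono' (Measure.restrict_mono hA le_rfl) fun _ => lintegral_mono_set hB)

theorem toReal_slobodeckijSq_eq {ω : Set Plane} (hω : MeasurableSet ω) (h : ω ⊆ Γ.carrier) :
    (slobodeckijSq ω u.toL2).toReal = interaction u ω ω := by
  have e : arc ω = (arc Γ.carrier).restrict ω := by
    rw [arc, arc, Measure.restrict_restrict hω, inter_eq_self_of_subset_left h]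
  rw [interaction, ← e]
  rfl

theorem toReal_slobodeckijSq_carrier :
    (slobodeckijSq Γ.carrier u.toL2).toReal = interaction u univ univ := by
  rw [interaction, Measure.restrict_univ]
  rfl

theorem integrable_sub_sq (c : ℝ) :
    Integrable (fun x => (u.toL2 x - c) ^ 2) (arc Γ.carrier) :=
  ((Lp.memLp u.toL2).sub (memLp_const c)).integrable_sq

theorem ofReal_deviationSq (c : ℝ) (A : Set Plane) :
    ENNReal.ofReal (deviationSq u c A) = ∫⁻ x in A, ‖u.toL2 x - c‖ₑ ^ 2 ∂(arc Γ.carrier) := by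
  rw [deviationSq, ofReal_integral_eq_lintegral_ofReal (integrable_sub_sq u c).integrableOn
    (Filter.Eventually.of_forall fun _ => sq_nonneg _)]
  refine lintegral_congr fun x => ?_
  rw [Real.enorm_eq_ofReal_abs, ← ENNReal.ofReal_pow (abs_nonneg _), sq_abs]

theorem deviationSq_mono (c : ℝ) {A B : Set Plane} (h : A ⊆ B) :
    deviationSq u c A ≤ deviationSq u c B := by
  rw [← ENNReal.ofReal_le_ofReal_iff (deviationSq_nonneg u c B), ofReal_deviationSq,
    ofReal_deviationSq]
  exact lintegral_mono_set h

theorem deviationSq_le_sum {ι : Type*} (s : Finset ι) {A : ι → Set Plane} {S : Set Plane}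
    (hS : S ⊆ ⋃ i ∈ s, A i) (c : ℝ) : deviationSq u c S ≤ ∑ i ∈ s, deviationSq u c (A i) := by
  rw [← ENNReal.ofReal_le_ofReal_iff (Finset.sum_nonneg fun i _ => deviationSq_nonneg u c _),
    ENNReal.ofReal_sum_of_nonneg fun i _ => deviationSq_nonneg u c _]
  simp only [ofReal_deviationSq]
  exact setLIntegral_le_sum_of_subset_biUnion s hS _

variable (Γ) in
theorem arc_restrict_carrier : (arc Γ.carrier).restrict Γ.carrier = arc Γ.carrier := by
  rw [arc, Measure.restrict_restrict Γ.isCompact_carrier.measurableSet, inter_self]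

theorem norm_toL2_sq : ‖u.toL2‖ ^ 2 = deviationSq u 0 Γ.carrier := by
  have h : deviationSq u 0 Γ.carrier = ∫ x, (u.toL2 x) ^ 2 ∂(arc Γ.carrier) := by
    simp only [deviationSq, sub_zero]
    rw [arc_restrict_carrier]
  rw [h, ← real_inner_self_eq_norm_sq, L2.inner_def]
  refine integral_congr_ae (Filter.Eventually.of_forall fun x => ?_)
  simp [sq]

theorem HHalf_norm_sq :
    ‖u‖ ^ 2 = deviationSq u 0 Γ.carrier + interaction u univ univ := by
  rw [HHalf.norm_def, Real.sq_sqrt (by positivity), norm_toL2_sq, toReal_slobodeckijSq_carrier]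

namespace Mesh

variable (𝒯 : Γ.Mesh)

theorem faermann_eq :
    𝒯.faermann u = √(∑ z ∈ 𝒯.nodes, interaction u (𝒯.nodePatch z) (𝒯.nodePatch z)) := by
  rw [faermann]
  congr 1
  exact Finset.sum_congr rfl fun z _ =>
    toReal_slobodeckijSq_eq u (𝒯.measurableSet_nodePatch z) (𝒯.nodePatch_subset_carrier z)

/-! ### Efficiency: bounded overlap of the node patches -/

theorem sum_interaction_nodePatch_le :
    ∑ z ∈ 𝒯.nodes, interaction u (𝒯.nodePatch z) (𝒯.nodePatch z) ≤
      4 * interaction u univ univ := by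
  classical
  have hK := measurable_slobodeckijKernel (measurable_toL2 u)
  set G : Plane → ℝ≥0∞ := fun x => ∫⁻ y in univ, slobodeckijKernel u.toL2 (x, y) ∂(arc Γ.carrier)
    with hG
  have hGm : Measurable G := hK.lintegral_prod_right'
  rw [← ENNReal.ofReal_le_ofReal_iff (mul_nonneg (by norm_num) (interaction_nonneg u _ _)),
    ENNReal.ofReal_sum_of_nonneg fun z _ => interaction_nonneg u _ _,
    ENNReal.ofReal_mul (by norm_num)]
  simp only [ofReal_interaction]
  rw [← hG]
  calc _ ≤ ∑ z ∈ 𝒯.nodes, ∫⁻ x in 𝒯.nodePatch z, G x ∂(arc Γ.carrier) :=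
        Finset.sum_le_sum fun z _ => lintegral_mono fun x => lintegral_mono_set (subset_univ _)
    _ = ∫⁻ x, ∑ z ∈ 𝒯.nodes, (𝒯.nodePatch z).indicator G x ∂(arc Γ.carrier) := by
        rw [lintegral_finsetSum _ fun z _ => hGm.indicator (𝒯.measurableSet_nodePatch z)]
        exact Finset.sum_congr rfl fun z _ =>
          (lintegral_indicator (𝒯.measurableSet_nodePatch z) _).symm
    _ ≤ ∫⁻ x, 4 * G x ∂(arc Γ.carrier) := by
        refine lintegral_mono fun x => ?_
        simp only [indicator_apply]
        rw [← Finset.sum_filter, Finset.sum_const, nsmul_eq_mul]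
        gcongr
        exact_mod_cast 𝒯.card_nodePatches_of_mem_le x
    _ = _ := by
        rw [lintegral_const_mul _ hGm, Measure.restrict_univ]
        simp

theorem faermann_le_norm : 𝒯.faermann u ≤ 2 * ‖u‖ := by
  rw [faermann_eq]
  refine Real.sqrt_le_iff.2 ⟨by positivity, (𝒯.sum_interaction_nodePatch_le u).trans ?_⟩
  have := HHalf_norm_sq u
  have h0 := deviationSq_nonneg u 0 Γ.carrier
  nlinarith

/-! ### Reliability: neighbouring elements and the far field -/

open Classical in
/-- The contribution to the seminorm of an element together with the elements that meet it. -/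
noncomputable def nearInteraction (j : Fin 𝒯.n) : ℝ :=
  ∑ i with (𝒯.element i ∩ 𝒯.element j).Nonempty, interaction u (𝒯.element j) (𝒯.element i)

theorem nearInteraction_nonneg (j : Fin 𝒯.n) : 0 ≤ 𝒯.nearInteraction u j :=
  Finset.sum_nonneg fun _ _ => interaction_nonneg u _ _

theorem interaction_le_nearInteraction {i j : Fin 𝒯.n}
    (h : (𝒯.element i ∩ 𝒯.element j).Nonempty) :
    interaction u (𝒯.element j) (𝒯.element i) ≤ 𝒯.nearInteraction u j := by
  classical
  exact Finset.single_le_sum (f := fun i => interaction u (𝒯.element j) (𝒯.element i))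
    (fun i _ => interaction_nonneg u _ _) (Finset.mem_filter.2 ⟨Finset.mem_univ i, h⟩)

/-- Elements that meet lie in a common node patch, and a node patch consists of at most two
elements. -/
theorem sum_nearInteraction_le :
    ∑ j, 𝒯.nearInteraction u j ≤
      4 * ∑ z ∈ 𝒯.nodes, interaction u (𝒯.nodePatch z) (𝒯.nodePatch z) := by
  classical
  set I : Plane → ℝ := fun z => interaction u (𝒯.nodePatch z) (𝒯.nodePatch z)
  have hI : ∀ z, 0 ≤ I z := fun z => interaction_nonneg u _ _
  have h1 : ∀ j, 𝒯.nearInteraction u j ≤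
      ∑ i, ∑ z ∈ 𝒯.nodes, if z ∈ 𝒯.element i ∧ z ∈ 𝒯.element j then I z else 0 := by
    intro j
    have hnn : ∀ i, 0 ≤ ∑ z ∈ 𝒯.nodes,
        if z ∈ 𝒯.element i ∧ z ∈ 𝒯.element j then I z else 0 := fun i =>
      Finset.sum_nonneg fun z _ => by split_ifs <;> simp [hI]
    refine (Finset.sum_le_sum fun i hi => ?_).trans
      (Finset.sum_le_sum_of_subset_of_nonneg (Finset.filter_subset _ _) fun i _ _ => hnn i)
    obtain ⟨z, hz, hzi, hzj⟩ := 𝒯.exists_node_of_inter_nonempty (Finset.mem_filter.1 hi).2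
    refine (interaction_mono u (𝒯.element_subset_nodePatch hzj)
      (𝒯.element_subset_nodePatch hzi)).trans ?_
    refine le_trans ?_ (Finset.single_le_sum (f := fun z =>
      if z ∈ 𝒯.element i ∧ z ∈ 𝒯.element j then I z else 0)
      (fun z _ => by split_ifs <;> simp [hI]) hz)
    simp only [hzi, hzj, and_self, if_true]
    exact le_rfl
  refine (Finset.sum_le_sum fun j _ => h1 j).trans ?_
  have h2 : ∀ z, ∑ j, ∑ i, (if z ∈ 𝒯.element i ∧ z ∈ 𝒯.element j then I z else 0) ≤ 4 * I z := by
    intro z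
    have hcard : ((Finset.univ.filter fun i => z ∈ 𝒯.element i).card : ℝ) ≤ 2 := by
      exact_mod_cast 𝒯.card_elements_of_mem_le z
    have : ∀ j, ∑ i, (if z ∈ 𝒯.element i ∧ z ∈ 𝒯.element j then I z else 0)
        = if z ∈ 𝒯.element j then
          ((Finset.univ.filter fun i => z ∈ 𝒯.element i).card : ℝ) * I z else 0 := by
      intro j
      by_cases hj : z ∈ 𝒯.element j
      · simp only [hj, and_true, if_true]
        rw [← Finset.sum_filter, Finset.sum_const, nsmul_eq_mul]
      · simp [hj]
    simp only [this]
    rw [← Finset.sum_filter, Finset.sum_const, nsmul_eq_mul, ← mul_assoc]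
    gcongr
    · exact hI z
    · nlinarith [Nat.cast_nonneg (α := ℝ) (Finset.univ.filter fun i => z ∈ 𝒯.element i).card]
  have h3 : ∑ j, ∑ i, ∑ z ∈ 𝒯.nodes, (if z ∈ 𝒯.element i ∧ z ∈ 𝒯.element j then I z else 0)
      = ∑ z ∈ 𝒯.nodes, ∑ j, ∑ i, (if z ∈ 𝒯.element i ∧ z ∈ 𝒯.element j then I z else 0) := by
    rw [Finset.sum_comm]
    simp only [Finset.sum_comm (s := Finset.univ) (t := 𝒯.nodes)]
    refine Finset.sum_congr rfl fun z _ => ?_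
    rw [Finset.sum_comm]
  rw [h3, Finset.mul_sum]
  exact Finset.sum_le_sum fun z _ => h2 z

theorem carrier_subset_iUnion_element : Γ.carrier ⊆ ⋃ j ∈ Finset.univ, 𝒯.element j := by
  intro x hx
  obtain ⟨j, hj⟩ := 𝒯.exists_mem_element hx
  exact mem_iUnion₂.2 ⟨j, Finset.mem_univ j, hj⟩

/-- The seminorm on `Γ` is bounded by the contributions of neighbouring elements and a weighted `L²`
norm. -/
theorem interaction_univ_le {c L : ℝ} (hΓ : Γ.IsChordArc c L) {κ : ℝ} (hκ0 : 0 < κ)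
    (hκ : 𝒯.kappa ≤ κ) :
    interaction u univ univ ≤ ∑ j, 𝒯.nearInteraction u j +
      4 * (2 * L ^ 2 * κ / c ^ 2) * ∑ j, deviationSq u 0 (𝒯.element j) / 𝒯.size j := by
  classical
  have hc := hΓ.c_pos
  have hL := hΓ.L_pos
  have hsize := 𝒯.size_pos hΓ
  set μ := arc Γ.carrier with hμ
  set r : Plane → ℝ := ⇑u.toL2 with hr
  have hrm : Measurable r := measurable_toL2 u
  have hK := measurable_slobodeckijKernel hrm
  set P : Finset (Fin 𝒯.n × Fin 𝒯.n) :=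
    Finset.univ.filter fun p => (𝒯.element p.2 ∩ 𝒯.element p.1).Nonempty with hP
  set N : Set (Plane × Plane) := ⋃ p ∈ P, 𝒯.element p.1 ×ˢ 𝒯.element p.2 with hN
  have hNm : MeasurableSet N := Finset.measurableSet_biUnion _ fun p _ =>
    (𝒯.measurableSet_element _).prod (𝒯.measurableSet_element _)
  have hsymm : Prod.swap ⁻¹' N = N := by
    ext ⟨x, y⟩
    simp only [hN, hP, mem_preimage, Prod.swap_prod_mk, mem_iUnion, Finset.mem_filter,
      Finset.mem_univ, true_and, mem_prod, Prod.exists, exists_prop]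
    constructor <;> rintro ⟨i, j, h, h1, h2⟩ <;> exact ⟨j, i, by rwa [inter_comm], h2, h1⟩
  have hnear : ∫⁻ p in N, slobodeckijKernel r p ∂(μ.prod μ) ≤
      ENNReal.ofReal (∑ j, 𝒯.nearInteraction u j) := by
    refine (setLIntegral_le_sum_of_subset_biUnion P subset_rfl _).trans (le_of_eq ?_)
    have e : ∀ p : Fin 𝒯.n × Fin 𝒯.n,
        ∫⁻ q in 𝒯.element p.1 ×ˢ 𝒯.element p.2, slobodeckijKernel r q ∂(μ.prod μ)
          = ENNReal.ofReal (interaction u (𝒯.element p.1) (𝒯.element p.2)) := by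
      intro p
      rw [ofReal_interaction, ← Measure.prod_restrict, lintegral_prod _ hK.aemeasurable]
    simp only [e]
    rw [← ENNReal.ofReal_sum_of_nonneg fun p _ => interaction_nonneg u _ _]
    congr 1
    rw [hP, Finset.sum_filter, ← Finset.univ_product_univ, Finset.sum_product]
    simp only [nearInteraction, Finset.sum_filter]
  have hfar : ∫⁻ p in Nᶜ, ‖r p.1‖ₑ ^ 2 * (‖p.1 - p.2‖ₑ ^ 2)⁻¹ ∂(μ.prod μ) ≤
      ENNReal.ofReal (2 * L ^ 2 * κ / c ^ 2 *
        ∑ j, deviationSq u 0 (𝒯.element j) / 𝒯.size j) := by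
    have hfm : Measurable fun p : Plane × Plane => ‖r p.1‖ₑ ^ 2 * (‖p.1 - p.2‖ₑ ^ 2)⁻¹ := by
      have h1 : Measurable fun p : Plane × Plane => r p.1 := hrm.comp measurable_fst
      have h3 : Measurable fun p : Plane × Plane => p.1 - p.2 := by fun_prop
      exact (h1.enorm.pow_const 2).mul (h3.enorm.pow_const 2).inv
    rw [← lintegral_indicator hNm.compl, lintegral_prod _ (hfm.indicator hNm.compl).aemeasurable]
    have hcover : ∀ g : Plane → ℝ≥0∞, ∫⁻ x, g x ∂μ ≤ ∑ j, ∫⁻ x in 𝒯.element j, g x ∂μ := by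
      intro g
      calc ∫⁻ x, g x ∂μ = ∫⁻ x in Γ.carrier, g x ∂μ := by rw [hμ, arc_restrict_carrier]
        _ ≤ _ := setLIntegral_le_sum_of_subset_biUnion _ 𝒯.carrier_subset_iUnion_element _
    refine (hcover _).trans ?_
    rw [Finset.mul_sum, ENNReal.ofReal_sum_of_nonneg fun j _ =>
      mul_nonneg (by positivity) (div_nonneg (deviationSq_nonneg u _ _) (hsize j).le)]
    refine Finset.sum_le_sum fun j _ => ?_
    have hpm : MeasurableSet (𝒯.patch j 1) :=
      MeasurableSet.iUnion fun i => MeasurableSet.iUnion fun _ => 𝒯.measurableSet_element i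
    have hpt : ∀ x ∈ 𝒯.element j, ∫⁻ y, Nᶜ.indicator
        (fun p : Plane × Plane => ‖r p.1‖ₑ ^ 2 * (‖p.1 - p.2‖ₑ ^ 2)⁻¹) (x, y) ∂μ ≤
        ENNReal.ofReal (2 * L ^ 2 * κ / c ^ 2 / 𝒯.size j) * ‖r x - 0‖ₑ ^ 2 := by
      intro x hx
      have hmx : Measurable fun y : Plane => (‖x - y‖ₑ ^ 2)⁻¹ := by fun_prop
      calc _ ≤ ∫⁻ y, (𝒯.patch j 1)ᶜ.indicator
            (fun y => ‖r x‖ₑ ^ 2 * (‖x - y‖ₑ ^ 2)⁻¹) y ∂μ := by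
            refine lintegral_mono fun y => ?_
            by_cases hy : y ∈ 𝒯.patch j 1
            · obtain ⟨i, hij, hyi⟩ := mem_iUnion₂.1 hy
              have : (x, y) ∈ N := mem_iUnion₂.2 ⟨(j, i),
                Finset.mem_filter.2 ⟨Finset.mem_univ _, hij⟩, hx, hyi⟩
              rw [indicator_of_notMem (by simpa using this)]
              exact zero_le
            · rw [indicator_of_mem (show y ∈ (𝒯.patch j 1)ᶜ from hy)]
              exact indicator_le_self _ _ _
        _ = ‖r x‖ₑ ^ 2 * ∫⁻ y in (𝒯.patch j 1)ᶜ, (‖x - y‖ₑ ^ 2)⁻¹ ∂μ := by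
            rw [lintegral_indicator hpm.compl, lintegral_const_mul _ hmx]
        _ ≤ _ := by
            rw [mul_comm, sub_zero]
            gcongr
            exact 𝒯.lintegral_compl_patch_le hΓ hκ0 hκ hx
    refine (setLIntegral_mono' (𝒯.measurableSet_element j) hpt).trans (le_of_eq ?_)
    rw [lintegral_const_mul _ ((hrm.sub_const 0).enorm.pow_const 2), ← ofReal_deviationSq,
      ← ENNReal.ofReal_mul (div_nonneg (by positivity) (hsize j).le)]
    congr 1
    ring
  have hW : 0 ≤ ∑ j, deviationSq u 0 (𝒯.element j) / 𝒯.size j :=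
    Finset.sum_nonneg fun j _ => div_nonneg (deviationSq_nonneg u _ _) (hsize j).le
  have hNI : 0 ≤ ∑ j, 𝒯.nearInteraction u j :=
    Finset.sum_nonneg fun j _ => 𝒯.nearInteraction_nonneg u j
  rw [← ENNReal.ofReal_le_ofReal_iff (by positivity), ofReal_interaction, Measure.restrict_univ,
    ← lintegral_prod _ hK.aemeasurable, ← lintegral_add_compl _ hNm,
    ENNReal.ofReal_add hNI (by positivity)]
  refine add_le_add hnear ((lintegral_slobodeckijKernel_compl_le hrm hNm hsymm).trans ?_)
  rw [mul_assoc, ENNReal.ofReal_mul (by norm_num)]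
  gcongr
  simp

/-! ### Reliability: propagation along a patch -/

theorem arc_element (j : Fin 𝒯.n) :
    arc Γ.carrier (𝒯.element j) = ENNReal.ofReal (𝒯.size j) := by
  rw [size_eq_toReal, ENNReal.ofReal_toReal (measure_ne_top _ _)]

theorem card_patchElements_le (j : Fin 𝒯.n) (m : ℕ) : (𝒯.patchElements j m).card ≤ 4 ^ m := by
  classical
  induction m with
  | zero => simp [patchElements]
  | succ m ih =>
    exact (Finset.card_biUnion_le_card_mul _ _ 4 fun k _ => 𝒯.card_neighbours_le k).trans
      (by rw [pow_succ]; gcongr)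

theorem exists_deviationSq_le {c L : ℝ} (hΓ : Γ.IsChordArc c L) (j : Fin 𝒯.n) :
    ∃ c₀ : ℝ, deviationSq u c₀ (𝒯.element j) ≤
      (2 * L / c) ^ 2 * 𝒯.size j * 𝒯.nearInteraction u j := by
  have hj := 𝒯.size_pos hΓ j
  obtain ⟨c₀, h⟩ := exists_measure_mul_lintegral_sub_sq_le (μ := arc Γ.carrier)
    (measurable_toL2 u) (𝒯.measurableSet_element j) (by simp [arc_element, hj])
    (measure_ne_top _ _) (d := 2 * L / c * 𝒯.size j)
    fun x hx y hy => 𝒯.dist_le_of_mem_element hΓ hx hy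
  refine ⟨c₀, ?_⟩
  rw [arc_element, ← ofReal_deviationSq, ← ofReal_interaction, ← ENNReal.ofReal_mul hj.le,
    ← ENNReal.ofReal_mul (by positivity), ENNReal.ofReal_le_ofReal_iff
      (mul_nonneg (by positivity) (interaction_nonneg u _ _))] at h
  have hnear := 𝒯.interaction_le_nearInteraction u (i := j) (j := j)
    ⟨_, 𝒯.left_mem_element j, 𝒯.left_mem_element j⟩
  refine le_of_mul_le_mul_left (h.trans ?_) hj
  calc (2 * L / c * 𝒯.size j) ^ 2 * interaction u (𝒯.element j) (𝒯.element j)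
      ≤ (2 * L / c * 𝒯.size j) ^ 2 * 𝒯.nearInteraction u j := by gcongr
    _ = _ := by ring

theorem deviationSq_neighbour_le {c L : ℝ} (hΓ : Γ.IsChordArc c L) {κ : ℝ} (hκ0 : 0 < κ)
    (hκ : 𝒯.kappa ≤ κ) {i j : Fin 𝒯.n} (h : (𝒯.element i ∩ 𝒯.element j).Nonempty) (c₀ : ℝ) :
    deviationSq u c₀ (𝒯.element i) ≤
      2 * ((2 * L / c) * (1 + κ)) ^ 2 * 𝒯.size j * 𝒯.nearInteraction u j +
        2 * κ * deviationSq u c₀ (𝒯.element j) := by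
  have hc := hΓ.c_pos
  have hL := hΓ.L_pos
  have hi := 𝒯.size_pos hΓ i
  have hj := 𝒯.size_pos hΓ j
  have hij : 𝒯.size i ≤ κ * 𝒯.size j := (𝒯.size_le_kappa_mul h hj).trans (by gcongr)
  have hd : ∀ x ∈ 𝒯.element j, ∀ y ∈ 𝒯.element i,
      ‖x - y‖ ≤ (2 * L / c) * (1 + κ) * 𝒯.size j := by
    intro x hx y hy
    obtain ⟨w, hwi, hwj⟩ := h
    calc ‖x - y‖ ≤ ‖x - w‖ + ‖w - y‖ := norm_sub_le_norm_sub_add_norm_sub _ _ _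
      _ ≤ 2 * L / c * 𝒯.size j + 2 * L / c * 𝒯.size i :=
          add_le_add (𝒯.dist_le_of_mem_element hΓ hx hwj) (𝒯.dist_le_of_mem_element hΓ hwi hy)
      _ ≤ 2 * L / c * 𝒯.size j + 2 * L / c * (κ * 𝒯.size j) := by gcongr
      _ = _ := by ring
  have hmain := measure_mul_lintegral_sub_sq_le (μ := arc Γ.carrier) (measurable_toL2 u)
    (𝒯.measurableSet_element j) (𝒯.measurableSet_element i) hd c₀
  have hI := interaction_nonneg u (𝒯.element j) (𝒯.element i)
  have hD := deviationSq_nonneg u c₀ (𝒯.element j)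
  have h2 : (2 : ℝ≥0∞) = ENNReal.ofReal 2 := by simp
  rw [arc_element, arc_element, ← ofReal_deviationSq, ← ofReal_deviationSq, ← ofReal_interaction,
    ← ENNReal.ofReal_mul hj.le, h2, ← ENNReal.ofReal_mul two_pos.le,
    ← ENNReal.ofReal_mul two_pos.le, ← ENNReal.ofReal_mul (by positivity),
    ← ENNReal.ofReal_mul (by positivity), ← ENNReal.ofReal_add (by positivity) (by positivity),
    ENNReal.ofReal_le_ofReal_iff (by positivity)] at hmain
  refine le_of_mul_le_mul_left (hmain.trans ?_) hj
  have hnear := 𝒯.interaction_le_nearInteraction u h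
  calc _ ≤ 2 * ((2 * L / c) * (1 + κ) * 𝒯.size j) ^ 2 * 𝒯.nearInteraction u j +
        2 * (κ * 𝒯.size j) * deviationSq u c₀ (𝒯.element j) := by gcongr
    _ = _ := by ring

/-- The deviation from a constant on the patch of order `k` is controlled by the near-field
interactions of its elements, once it is on the central element. The constant grows with `k` but
does not depend on the mesh. -/
theorem exists_deviationSq_patchElements_le {c L : ℝ} (hΓ : Γ.IsChordArc c L) {κ : ℝ}
    (hκ1 : 1 ≤ κ) (k : ℕ) :
    ∃ C : ℝ, 0 ≤ C ∧ ∀ (𝒯 : Γ.Mesh) (u : HHalf Γ.carrier) (j : Fin 𝒯.n) (c₀ : ℝ), 𝒯.kappa ≤ κ →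
      deviationSq u c₀ (𝒯.element j) ≤ (2 * L / c) ^ 2 * 𝒯.size j * 𝒯.nearInteraction u j →
      ∀ i ∈ 𝒯.patchElements j k, 𝒯.size i ≤ κ ^ k * 𝒯.size j ∧
        deviationSq u c₀ (𝒯.element i) ≤
          C * 𝒯.size j * ∑ l ∈ 𝒯.patchElements j k, 𝒯.nearInteraction u l := by
  classical
  have hκ0 : 0 < κ := one_pos.trans_le hκ1
  induction k with
  | zero =>
    refine ⟨(2 * L / c) ^ 2, by positivity, fun 𝒯 u j c₀ _ h i hi => ?_⟩
    obtain rfl := Finset.mem_singleton.1 hi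
    simpa [patchElements] using h
  | succ k ih =>
    obtain ⟨C, hC, H⟩ := ih
    refine ⟨2 * ((2 * L / c) * (1 + κ)) ^ 2 * κ ^ k + 2 * κ * C, by positivity,
      fun 𝒯 u j c₀ hκ h i hi => ?_⟩
    obtain ⟨l, hl, hi'⟩ := Finset.mem_biUnion.1 hi
    have hil := (Finset.mem_filter.1 hi').2
    obtain ⟨h1, h2⟩ := H 𝒯 u j c₀ hκ h l hl
    have hj := 𝒯.size_pos hΓ j
    have hl0 := 𝒯.size_pos hΓ l
    have hsub : 𝒯.patchElements j k ⊆ 𝒯.patchElements j (k + 1) := fun p hp =>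
      Finset.mem_biUnion.2 ⟨p, hp, Finset.mem_filter.2
        ⟨Finset.mem_univ p, _, 𝒯.left_mem_element p, 𝒯.left_mem_element p⟩⟩
    have hS : ∑ l ∈ 𝒯.patchElements j k, 𝒯.nearInteraction u l ≤
        ∑ l ∈ 𝒯.patchElements j (k + 1), 𝒯.nearInteraction u l :=
      Finset.sum_le_sum_of_subset_of_nonneg hsub fun p _ _ => 𝒯.nearInteraction_nonneg u p
    have hN : 𝒯.nearInteraction u l ≤ ∑ l ∈ 𝒯.patchElements j (k + 1), 𝒯.nearInteraction u l :=
      Finset.single_le_sum (fun p _ => 𝒯.nearInteraction_nonneg u p) (hsub hl)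
    have hNl := 𝒯.nearInteraction_nonneg u l
    set S := ∑ l ∈ 𝒯.patchElements j (k + 1), 𝒯.nearInteraction u l
    constructor
    · calc 𝒯.size i ≤ κ * 𝒯.size l := (𝒯.size_le_kappa_mul hil hl0).trans (by gcongr)
        _ ≤ κ * (κ ^ k * 𝒯.size j) := by gcongr
        _ = _ := by ring
    · calc deviationSq u c₀ (𝒯.element i)
          ≤ 2 * ((2 * L / c) * (1 + κ)) ^ 2 * 𝒯.size l * 𝒯.nearInteraction u l +
            2 * κ * deviationSq u c₀ (𝒯.element l) :=
            𝒯.deviationSq_neighbour_le u hΓ hκ0 hκ hil c₀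
        _ ≤ 2 * ((2 * L / c) * (1 + κ)) ^ 2 * (κ ^ k * 𝒯.size j) * S +
            2 * κ * (C * 𝒯.size j * S) := by
            gcongr
            exact h2.trans (by gcongr)
        _ = _ := by ring

/-! ### Reliability: orthogonality -/

/-- Orthogonality to the function `ψ` of an element makes the norm of `u` on the element comparable
to its deviation from any constant on the support of `ψ`. -/
theorem mul_deviationSq_element_le {m : ℕ} {q : ℝ} (hq0 : 0 < q)
    (hq1 : q ≤ 1) {j : Fin 𝒯.n} {ψ : Plane → ℝ} (hψ : MemLp ψ 2 (arc Γ.carrier))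
    (horth : ∫ x, u.toL2 x * ψ x ∂(arc Γ.carrier) = 0) (hA1 : 𝒯.A1 m j ψ) (hA2 : Γ.A2 q ψ)
    (c₀ : ℝ) :
    q * deviationSq u 0 (𝒯.element j) ≤
      ∑ i ∈ 𝒯.patchElements j m, deviationSq u c₀ (𝒯.element i) := by
  obtain ⟨-, hT, hS⟩ := hA1
  have hSm : MeasurableSet (Γ.supp ψ) := isClosed_closure.measurableSet
  have e : arc (Γ.supp ψ) = (arc Γ.carrier).restrict (Γ.supp ψ) := by
    rw [arc, arc, Measure.restrict_restrict hSm,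
      inter_eq_self_of_subset_left (hS.trans (𝒯.patch_subset_carrier j m))]
  have horth' : ∫ x in Γ.supp ψ, u.toL2 x * ψ x ∂(arc Γ.carrier) = 0 := by
    rw [← horth]
    have h1 := setIntegral_eq_of_subset_of_forall_sdiff_eq_zero (μ := arc Γ.carrier)
      (f := fun x => u.toL2 x * ψ x) Γ.isCompact_carrier.measurableSet
      (hS.trans (𝒯.patch_subset_carrier j m)) ?_
    · rw [← h1, arc_restrict_carrier]
    · rintro x ⟨hx, hx'⟩
      have : ψ x = 0 := by
        by_contra h0
        exact hx' (subset_closure ⟨hx, h0⟩)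
      rw [this, mul_zero]
  have hmain := mul_integral_sq_le_of_orthogonal ((Lp.memLp u.toL2).restrict (Γ.supp ψ))
    (hψ.restrict (Γ.supp ψ)) horth' hq1 (by
      have := hA2
      rw [A2, arclength, e] at this
      exact this) c₀
  calc q * deviationSq u 0 (𝒯.element j) ≤ q * deviationSq u 0 (Γ.supp ψ) := by
        gcongr
        exact deviationSq_mono u 0 hT
    _ ≤ deviationSq u c₀ (Γ.supp ψ) := by simpa [deviationSq] using hmain
    _ ≤ _ := deviationSq_le_sum u _ (hS.trans (𝒯.patch_subset j m)) c₀

/-- The localized norm bound: functions orthogonal to a space with local functions close to `1` are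
bounded by their seminorms on node patches. -/
theorem exists_norm_le_faermann (Γ : BoundaryPart) (m : ℕ) (κ : ℝ) {q : ℝ} (hq0 : 0 < q)
    (hq1 : q ≤ 1) :
    ∃ C : ℝ, 0 < C ∧ ∀ (𝒯 : Γ.Mesh) (X : Submodule ℝ (L2 Γ.carrier)) (u : HHalf Γ.carrier),
      𝒯.kappa ≤ κ → 𝒯.SatisfiesA1A2 X m q →
      (∀ ψ ∈ X, ∫ x, u.toL2 x * ψ x ∂(arc Γ.carrier) = 0) → ‖u‖ ≤ C * 𝒯.faermann u := by
  obtain ⟨c, L, hΓ⟩ := Γ.exists_isChordArc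
  have hc := hΓ.c_pos
  have hL := hΓ.L_pos
  set κ' := max κ 1 with hκ'
  have hκ1 : 1 ≤ κ' := le_max_right _ _
  have hκ0 : 0 < κ' := one_pos.trans_le hκ1
  obtain ⟨C₁, hC₁, H⟩ := exists_deviationSq_patchElements_le hΓ hκ1 m
  set M := (arc Γ.carrier univ).toReal with hM
  have hM0 : 0 ≤ M := ENNReal.toReal_nonneg
  set C₂ := 4 ^ m * C₁ / q * 4 ^ m with hC₂
  have hC₂0 : 0 ≤ C₂ := by positivity
  set C₃ := (1 + (4 * (2 * L ^ 2 * κ' / c ^ 2) + M) * C₂) * 4 with hC₃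
  have hC₃0 : 0 < C₃ := by positivity
  refine ⟨√C₃, Real.sqrt_pos.2 hC₃0, fun 𝒯 X u hκ hX horth => ?_⟩
  have hκ2 : 𝒯.kappa ≤ κ' := hκ.trans (le_max_left _ _)
  have hsize := 𝒯.size_pos hΓ
  set η2 := ∑ z ∈ 𝒯.nodes, interaction u (𝒯.nodePatch z) (𝒯.nodePatch z) with hη
  set W := ∑ j, deviationSq u 0 (𝒯.element j) / 𝒯.size j with hW
  set N := ∑ j, 𝒯.nearInteraction u j with hN
  have hNη : N ≤ 4 * η2 := 𝒯.sum_nearInteraction_le u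
  have hW0 : 0 ≤ W :=
    Finset.sum_nonneg fun j _ => div_nonneg (deviationSq_nonneg u _ _) (hsize j).le
  have hWN : W ≤ C₂ * N := by
    have h1 : ∀ j, deviationSq u 0 (𝒯.element j) / 𝒯.size j ≤
        4 ^ m * C₁ / q * ∑ l ∈ 𝒯.patchElements j m, 𝒯.nearInteraction u l := by
      intro j
      obtain ⟨ψ, ⟨hψ, hψX⟩, hA1, hA2⟩ := hX j
      have horthψ : ∫ x, u.toL2 x * ψ x ∂(arc Γ.carrier) = 0 := by
        rw [← horth _ hψX]
        refine integral_congr_ae ?_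
        filter_upwards [hψ.coeFn_toLp] with x hx
        rw [hx]
      obtain ⟨c₀, hc₀⟩ := 𝒯.exists_deviationSq_le u hΓ j
      have h2 := 𝒯.mul_deviationSq_element_le u hq0 hq1 hψ horthψ hA1 hA2 c₀
      set S := ∑ l ∈ 𝒯.patchElements j m, 𝒯.nearInteraction u l
      have hS0 : 0 ≤ S := Finset.sum_nonneg fun l _ => 𝒯.nearInteraction_nonneg u l
      have h3 : ∑ i ∈ 𝒯.patchElements j m, deviationSq u c₀ (𝒯.element i) ≤
          4 ^ m * (C₁ * 𝒯.size j * S) := by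
        refine (Finset.sum_le_card_nsmul _ _ _ fun i hi =>
          (H 𝒯 u j c₀ hκ2 hc₀ i hi).2).trans ?_
        rw [nsmul_eq_mul]
        have hj := (hsize j).le
        gcongr
        exact_mod_cast 𝒯.card_patchElements_le j m
      rw [div_le_iff₀ (hsize j)]
      calc deviationSq u 0 (𝒯.element j)
          = (q * deviationSq u 0 (𝒯.element j)) / q := by field_simp
        _ ≤ (4 ^ m * (C₁ * 𝒯.size j * S)) / q := by
            exact div_le_div_of_nonneg_right (h2.trans h3) hq0.le
        _ = _ := by ring
    calc W ≤ ∑ j, 4 ^ m * C₁ / q * ∑ l ∈ 𝒯.patchElements j m, 𝒯.nearInteraction u l :=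
          Finset.sum_le_sum fun j _ => h1 j
      _ ≤ 4 ^ m * C₁ / q * (4 ^ m * N) := by
          rw [← Finset.mul_sum]
          gcongr
          exact 𝒯.sum_patchElements_le m _ fun l => 𝒯.nearInteraction_nonneg u l
      _ = C₂ * N := by ring
  have hL2 : deviationSq u 0 Γ.carrier ≤ M * W := by
    refine (deviationSq_le_sum u _ 𝒯.carrier_subset_iUnion_element 0).trans ?_
    rw [hW, Finset.mul_sum]
    refine Finset.sum_le_sum fun j _ => ?_
    have h1 : 𝒯.size j ≤ M := by
      rw [size_eq_toReal]
      exact ENNReal.toReal_mono (measure_ne_top _ _) (measure_mono (subset_univ _))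
    rw [mul_div_assoc', le_div_iff₀ (hsize j), mul_comm]
    exact mul_le_mul_of_nonneg_right h1 (deviationSq_nonneg u _ _)
  have hsemi := 𝒯.interaction_univ_le u hΓ hκ0 hκ2
  have hfinal : ‖u‖ ^ 2 ≤ C₃ * η2 := by
    rw [HHalf_norm_sq]
    calc deviationSq u 0 Γ.carrier + interaction u univ univ
        ≤ M * W + (N + 4 * (2 * L ^ 2 * κ' / c ^ 2) * W) := add_le_add hL2 hsemi
      _ = N + (4 * (2 * L ^ 2 * κ' / c ^ 2) + M) * W := by ring
      _ ≤ N + (4 * (2 * L ^ 2 * κ' / c ^ 2) + M) * (C₂ * N) := by gcongr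
      _ = (1 + (4 * (2 * L ^ 2 * κ' / c ^ 2) + M) * C₂) * N := by ring
      _ ≤ (1 + (4 * (2 * L ^ 2 * κ' / c ^ 2) + M) * C₂) * (4 * η2) := by gcongr
      _ = C₃ * η2 := by ring
  rw [faermann_eq, ← Real.sqrt_mul hC₃0.le, ← Real.sqrt_sq (norm_nonneg u)]
  exact Real.sqrt_le_sqrt hfinal

end Mesh

/-- Functionals separate points, so the weak formulation is the equation `V φ = f`, and the
residual is the image of the error. -/
theorem residual_eq_of_isWeakSolution {V : HMinusHalf Γ.carrier ≃L[ℝ] HHalf Γ.carrier}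
    {f : HHalf Γ.carrier} {φ : HMinusHalf Γ.carrier} (h : IsWeakSolution V f φ)
    (χ : HMinusHalf Γ.carrier) : f - V χ = V (φ - χ) := by
  have : V φ = f := by
    by_contra hne
    obtain ⟨ψ, hψ⟩ := SeparatingDual.exists_ne_zero (R := ℝ) (sub_ne_zero.2 hne)
    exact hψ (by rw [map_sub, h ψ, sub_self])
  rw [map_sub, this]

theorem integral_residual_mul_eq_zero {V : HMinusHalf Γ.carrier ≃L[ℝ] HHalf Γ.carrier}
    {f : HHalf Γ.carrier} {X : Submodule ℝ (L2 Γ.carrier)} {φh : L2 Γ.carrier}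
    (h : IsGalerkinSolution V f X φh) {ψ : L2 Γ.carrier} (hψ : ψ ∈ X) :
    ∫ x, (f - V (ofL2 φh)).toL2 x * ψ x ∂(arc Γ.carrier) = 0 := by
  rw [← ofL2_apply, map_sub, ofL2_apply, ofL2_apply, h.2 ψ hψ, sub_self]

end BoundaryPart

end FaermannBEM

open FaermannBEM BoundaryPart in
theorem theorem3p1 (Γ : BoundaryPart) (V : HMinusHalf Γ.carrier ≃L[ℝ] HHalf Γ.carrier)
    (hV : IsElliptic V) :
    (∃ Ceff : ℝ, 0 < Ceff ∧
      ∀ (𝒯 : Γ.Mesh) (X : Submodule ℝ (L2 Γ.carrier)) (f : HHalf Γ.carrier)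
        (φ : HMinusHalf Γ.carrier) (φh : L2 Γ.carrier),
        IsWeakSolution V f φ → IsGalerkinSolution V f X φh →
          𝒯.faermann (f - V (ofL2 φh)) ≤ Ceff * ‖φ - ofL2 φh‖) ∧
    (∀ (m : ℕ) (κ q : ℝ), 0 < q → q ≤ 1 → ∃ Crel : ℝ, 0 < Crel ∧
      ∀ (𝒯 : Γ.Mesh) (X : Submodule ℝ (L2 Γ.carrier)) (f : HHalf Γ.carrier)
        (φ : HMinusHalf Γ.carrier) (φh : L2 Γ.carrier),
        𝒯.kappa ≤ κ → 𝒯.SatisfiesA1A2 X m q →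
        IsWeakSolution V f φ → IsGalerkinSolution V f X φh →
          ‖φ - ofL2 φh‖ ≤ Crel * 𝒯.faermann (f - V (ofL2 φh))) := by
  refine ⟨⟨2 * (‖(V : HMinusHalf Γ.carrier →L[ℝ] HHalf Γ.carrier)‖ + 1), by positivity,
    fun 𝒯 X f φ φh hφ _ => ?_⟩, fun m κ q hq0 hq1 => ?_⟩
  · rw [residual_eq_of_isWeakSolution hφ]
    refine (𝒯.faermann_le_norm _).trans ?_
    rw [mul_assoc]
    gcongr
    refine ((V : HMinusHalf Γ.carrier →L[ℝ] HHalf Γ.carrier).le_opNorm _).trans ?_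
    gcongr
    linarith
  · obtain ⟨C, hC, H⟩ := Mesh.exists_norm_le_faermann Γ m κ hq0 hq1
    refine ⟨(‖(V.symm : HHalf Γ.carrier →L[ℝ] HMinusHalf Γ.carrier)‖ + 1) * C, by positivity,
      fun 𝒯 X f φ φh hκ hX hφ hφh => ?_⟩
    have hr := H 𝒯 X (f - V (ofL2 φh)) hκ hX fun ψ hψ => integral_residual_mul_eq_zero hφh hψ
    have he : φ - ofL2 φh = V.symm (f - V (ofL2 φh)) := by
      rw [residual_eq_of_isWeakSolution hφ, V.symm_apply_apply]
    calc ‖φ - ofL2 φh‖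
        ≤ ‖(V.symm : HHalf Γ.carrier →L[ℝ] HMinusHalf Γ.carrier)‖ * ‖f - V (ofL2 φh)‖ := by
          rw [he]
          exact (V.symm : HHalf Γ.carrier →L[ℝ] HMinusHalf Γ.carrier).le_opNorm _
      _ ≤ (‖(V.symm : HHalf Γ.carrier →L[ℝ] HMinusHalf Γ.carrier)‖ + 1) *
            (C * 𝒯.faermann (f - V (ofL2 φh))) := by
          gcongr
          linarith
      _ = _ := by ring
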